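/- \textbf{Theorem.} Let $k$ be a finite field with $q$ elements, let $K$ be a finite extension of $k(t)$, and let $R$ be the integral closure of $k[t]$ in $K$. Let $F=k((1/t))$ be the completion of $k(t)$ at infinity, with its valuation $v$ normalized by $v(1/t)=1$, let $F^{\rm sep}$ be a separable closure of $F$ and $G={\rm Gal}(F^{\rm sep}/F)$. Put $K_\infty=F\otimes_{k(t)}K$ and $K_\infty^{\rm sep}=F^{\rm sep}\otimes_{k(t)}K$, with their topologies as finite free modules over the valued fields $F$ and $F^{\rm sep}$, and let $G$ act on $K_\infty^{\rm sep}$ through the first factor. Let $E$ be the Carlitz module: for a $k[t]$-algebra $B$, $E(B)$ is the additive group of $B$ with the $k[t]$-module structure in which $k$ acts by multiplication and $t$ acts by $b\mapsto tb+b^q$, while ${\rm Lie}_E(B)=B$ with $k[t]$ acting by multiplication. Let $\exp_E(X)=\sum_{i\ge 0}e_iX^{q^i}\in k(t)[[X]]$ be the unique such series with $e_0=1$ and $t\exp_E(X)+\exp_E(X)^q=\exp_E(tX)$, and let $\Lambda_E$ be the kernel of $\exp_E\colon{\rm Lie}_E(K_\infty^{\rm sep})\to E(K_\infty^{\rm sep})$.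 The connecting map $E(K_\infty)\to{\rm H}^1(G,\Lambda_E)$ (continuous cohomology, $\Lambda_E$ discrete), which sends $y$ to the class of the cocycle $\sigma\mapsto\sigma x-x$ for any $x\in {\rm Lie}_E(K_\infty^{\rm sep})$ with $\exp_E(x)=y$, is a well-defined $k[t]$-linear map; let $H_R$ be the cokernel of its restriction $E(R)\to{\rm H}^1(G,\Lambda_E)$. Then $H_R$ is finite. Let $|H_R|\in k[t]$ be the monic generator of the (zeroth) Fitting ideal of the $k[t]$-module $H_R$. Let $\exp_E^{-1}(E(R))\subset{\rm Lie}_E(K_\infty)$ be the $k[t]$-submodule of all $x\in K_\infty$ with $\exp_E(x)\in R$, and let $$\rho\colon F\otimes_{k[t]}\exp_E^{-1}(E(R))\to F\otimes_{k[t]}{\rm Lie}_E(R)={\rm Lie}_E(K_\infty)$$ be the $F$-linear map induced by the inclusion. Both $\exp_E^{-1}(E(R))$ and ${\rm Lie}_E(R)$ are free $k[t]$-modules of the same finite rank, and the determinants of $\rho$ with respect to $k[t]$-bases of these two modules form one class in $F^\times/k[t]^\times$; let ${\rm Reg}_R\in F$ be the unique monic representative of this class (monic: with leading term $t^n$ for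 some $n\in\mathbf Z$). Then $$v({\rm Reg}_R\cdot|H_R|)=0\qquad\text{and}\qquad v({\rm Reg}_R)=\dim_k H_R.$$ -/

import Mathlib

open scoped Polynomial TensorProduct NNReal WithZero

set_option linter.unusedSectionVars false

noncomputable section

namespace Carlitz

/-! ### The local field `k((1/t))` and its separable closure -/

section LocalField

variable (k : Type*) [Field k] [DecidableEq (RatFunc k)]

/-- The field `k((1/t))`, the completion of `k(t)` at the place at infinity. Its valuation
`Valued.v` is written multiplicatively: `Valued.v f = exp (-v(f))`, where `v` is the additive
valuation normalized by `v(t) = -1`. -/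
abbrev KInfty : Type _ := RatFunc.CompletionAtInfty k

instance : Algebra k[X] (KInfty k) :=
  ((algebraMap (RatFunc k) (KInfty k)).comp (algebraMap k[X] (RatFunc k))).toAlgebra

instance : IsScalarTower k[X] (RatFunc k) (KInfty k) := .of_algebraMap_eq fun _ => rfl

theorem valued_algebraMap (f : RatFunc k) :
    Valued.v (algebraMap (RatFunc k) (KInfty k) f) = RatFunc.inftyValuation k f :=
  @Valued.extensionValuation_apply_coe (RatFunc k) _ ℤᵐ⁰ _ (RatFunc.inftyValued k) f

instance : Valuation.RankOne (Valued.v : Valuation (KInfty k) ℤᵐ⁰) where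
  hom' := (WithZeroMulInt.toNNReal (e := 2) two_ne_zero).comp
    MonoidWithZeroHom.ValueGroup₀.embedding
  strictMono' := (WithZeroMulInt.toNNReal_strictMono (e := 2) one_lt_two).comp
    MonoidWithZeroHom.ValueGroup₀.embedding_strictMono
  exists_val_nontrivial :=
    ⟨algebraMap (RatFunc k) (KInfty k) RatFunc.X, by simp [valued_algebraMap]⟩

/-- The absolute value on `k((1/t))` with `|t| = 2`; its topology is the valuation topology. -/
instance : NontriviallyNormedField (KInfty k) := Valued.toNontriviallyNormedField (KInfty k) ℤᵐ⁰

instance : IsUltrametricDist (KInfty k) :=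
  Valued.instIsUltrametricDist (KInfty k) ℤᵐ⁰

instance : CompleteSpace (KInfty k) :=
  @UniformSpace.Completion.completeSpace (RatFunc k) (RatFunc.inftyValued k).toUniformSpace

/-- The separable closure `k((1/t))^sep`. -/
def KSep : Type _ := SeparableClosure (KInfty k)

instance : Field (KSep k) := inferInstanceAs (Field (SeparableClosure (KInfty k)))

instance : Algebra (KInfty k) (KSep k) :=
  inferInstanceAs (Algebra (KInfty k) (SeparableClosure (KInfty k)))

instance : IsSepClosure (KInfty k) (KSep k) :=
  inferInstanceAs (IsSepClosure (KInfty k) (SeparableClosure (KInfty k)))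

instance : Algebra.IsSeparable (KInfty k) (KSep k) := IsSepClosure.separable

instance : Algebra (RatFunc k) (KSep k) :=
  ((algebraMap (KInfty k) (KSep k)).comp (algebraMap (RatFunc k) (KInfty k))).toAlgebra

instance : IsScalarTower (RatFunc k) (KInfty k) (KSep k) := .of_algebraMap_eq fun _ => rfl

instance : Algebra k[X] (KSep k) :=
  ((algebraMap (RatFunc k) (KSep k)).comp (algebraMap k[X] (RatFunc k))).toAlgebra

instance : IsScalarTower k[X] (RatFunc k) (KSep k) := .of_algebraMap_eq fun _ => rfl

/-- The separable closure carries the unique extension of the absolute value of `k((1/t))`. -/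
instance : NormedField (KSep k) := spectralNorm.normedField (KInfty k) (KSep k)

end LocalField

/-! ### The Carlitz module and its exponential -/

section Exponential

variable (k : Type*) [Field k] [Fintype k]

/-- The `k`-linear endomorphism `b ↦ t b + b ^ q` of a `k[t]`-algebra `B`, where `q = #k`. -/
def carlitzT (B : Type*) [CommRing B] [Algebra k[X] B] :
    letI : Algebra k B := Algebra.compHom B (Polynomial.C : k →+* k[X])
    B →ₗ[k] B :=
  letI : Algebra k B := Algebra.compHom B (Polynomial.C : k →+* k[X])
  LinearMap.mulLeft k (algebraMap k[X] B Polynomial.X) +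
    (FiniteField.frobeniusAlgHom k B).toLinearMap

/-- The `k[t]`-module `E(B)` of `B`-points of the Carlitz module `E`: the additive group of the
`k[t]`-algebra `B`, on which `k` acts as usual and `t` acts by `b ↦ t b + b ^ q`. -/
def Points (B : Type*) [CommRing B] [Algebra k[X] B] : Type _ :=
  letI : Algebra k B := Algebra.compHom B (Polynomial.C : k →+* k[X])
  Module.AEval' (carlitzT k B)

variable {k} {B : Type*} [CommRing B] [Algebra k[X] B]

instance : AddCommGroup (Points k B) :=
  letI : Algebra k B := Algebra.compHom B (Polynomial.C : k →+* k[X])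
  inferInstanceAs (AddCommGroup (Module.AEval' (carlitzT k B)))

instance : Module k[X] (Points k B) :=
  letI : Algebra k B := Algebra.compHom B (Polynomial.C : k →+* k[X])
  inferInstanceAs (Module k[X] (Module.AEval' (carlitzT k B)))

/-- The identification of the additive group `E(B)` with `B`. -/
def Points.of : B ≃+ Points k B :=
  letI : Algebra k B := Algebra.compHom B (Polynomial.C : k →+* k[X])
  (Module.AEval'.of (carlitzT k B)).toAddEquiv

theorem X_smul_of (b : B) : (Polynomial.X : k[X]) • (Points.of b : Points k B) =
    Points.of (algebraMap k[X] B Polynomial.X * b + b ^ Fintype.card k) :=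
  letI : Algebra k B := Algebra.compHom B (Polynomial.C : k →+* k[X])
  Module.AEval'.X_smul_of (carlitzT k B) b

theorem C_smul_of (a : k) (b : B) : (Polynomial.C a : k[X]) • (Points.of b : Points k B) =
    Points.of (algebraMap k[X] B (Polynomial.C a) * b) :=
  letI : Algebra k B := Algebra.compHom B (Polynomial.C : k →+* k[X])
  (Module.AEval.C_smul (a := carlitzT k B) a (Module.AEval'.of (carlitzT k B) b)).trans
    (Algebra.smul_def (R := k) a b)

/-- The `k[t]`-linear map `E(B) → E(B')` given by a homomorphism `B → B'` of `k[t]`-algebras. -/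
def Points.map {B' : Type*} [CommRing B'] [Algebra k[X] B'] (f : B →ₐ[k[X]] B') :
    Points k B →ₗ[k[X]] Points k B' where
  toFun y := Points.of (f (Points.of.symm y))
  map_add' y z := by simp
  map_smul' p y := by
    obtain ⟨b, rfl⟩ := (Points.of (k := k) (B := B)).surjective y
    simp only [AddEquiv.symm_apply_apply, RingHom.id_apply]
    induction p using Polynomial.induction_on generalizing b with
    | C a => simp [C_smul_of]
    | add p q hp hq => simp only [add_smul, map_add, hp, hq]
    | monomial n a hn =>
      rw [pow_succ, ← mul_assoc, mul_smul _ Polynomial.X, mul_smul _ Polynomial.X, X_smul_of,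
        X_smul_of, hn]
      simp

variable (k)

/-- The coefficients `e_i` of the Carlitz exponential `exp_E(X) = ∑ e_i X ^ (q ^ i)`. -/
def expCoeff : ℕ → RatFunc k
  | 0 => 1
  | i + 1 => expCoeff i ^ Fintype.card k /
      (RatFunc.X ^ Fintype.card k ^ (i + 1) - RatFunc.X)

theorem X_pow_sub_X_ne_zero (i : ℕ) :
    (RatFunc.X ^ Fintype.card k ^ (i + 1) - RatFunc.X : RatFunc k) ≠ 0 := by
  have h1 : 1 < Fintype.card k ^ (i + 1) := Nat.one_lt_pow (by omega) Fintype.one_lt_card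
  have h := FiniteField.X_pow_card_sub_X_ne_zero k h1
  intro h0
  apply h
  apply RatFunc.algebraMap_injective k
  simpa [RatFunc.algebraMap_X] using h0

/-- The coefficients satisfy `φ(t) exp_E(X) = exp_E(t X)`, compared in degree `q ^ (i + 1)`. -/
theorem expCoeff_succ (i : ℕ) :
    RatFunc.X * expCoeff k (i + 1) + expCoeff k i ^ Fintype.card k =
      expCoeff k (i + 1) * RatFunc.X ^ Fintype.card k ^ (i + 1) := by
  have h := X_pow_sub_X_ne_zero k i
  rw [expCoeff]
  field_simp
  ring

variable {k}

/-- `HasExp x y` means that the series `exp_E(x) = ∑ e_i x ^ (q ^ i)` converges to `y`; here `x`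
is an element of `Lie_E(B) = B` and `y` an element of `E(B)`. -/
def HasExp {B : Type*} [CommRing B] [TopologicalSpace B] [Algebra (RatFunc k) B] [Algebra k[X] B]
    (x : B) (y : Points k B) : Prop :=
  HasSum (fun i => expCoeff k i • x ^ Fintype.card k ^ i) (Points.of.symm y)

section

variable {B : Type*} [CommRing B] [TopologicalSpace B] [IsTopologicalRing B]
  [Algebra (RatFunc k) B] [Algebra k[X] B] [IsScalarTower k[X] (RatFunc k) B]

theorem HasExp.zero : HasExp (0 : B) (0 : Points k B) := by
  have : (fun i => expCoeff k i • (0 : B) ^ Fintype.card k ^ i) = fun _ => 0 := by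
    funext i
    simp
  rw [HasExp, this, map_zero]
  exact hasSum_zero

theorem add_pow_card_pow (x y : B) (i : ℕ) :
    (x + y) ^ Fintype.card k ^ i = x ^ Fintype.card k ^ i + y ^ Fintype.card k ^ i := by
  let : Algebra k B := Algebra.compHom B (Polynomial.C : k →+* k[X])
  simpa [AlgHom.coe_pow, FiniteField.coe_frobeniusAlgHom, pow_iterate] using
    map_add (FiniteField.frobeniusAlgHom k B ^ i) x y

theorem HasExp.add {x x' : B} {y y' : Points k B} (h : HasExp x y) (h' : HasExp x' y') :
    HasExp (x + x') (y + y') := by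
  unfold HasExp at *
  simpa [add_pow_card_pow (k := k), smul_add] using HasSum.add h h'

theorem HasExp.C_smul {x : B} {y : Points k B} (a : k) (h : HasExp x y) :
    HasExp ((Polynomial.C a : k[X]) • x) ((Polynomial.C a : k[X]) • y) := by
  obtain ⟨y, rfl⟩ := Points.of.surjective y
  rw [C_smul_of]
  unfold HasExp at *
  simp only [AddEquiv.symm_apply_apply] at *
  refine (congrArg (HasSum · _) (funext fun i => ?_)).mp (HasSum.mul_left (algebraMap k[X] B (Polynomial.C a)) h)
  rw [Algebra.smul_def (Polynomial.C a), mul_pow, ← map_pow, ← map_pow, FiniteField.pow_card_pow,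
    mul_smul_comm]

theorem HasExp.X_smul {x : B} {y : Points k B} (h : HasExp x y) :
    HasExp ((Polynomial.X : k[X]) • x) ((Polynomial.X : k[X]) • y) := by
  obtain ⟨y, rfl⟩ := Points.of.surjective y
  rw [X_smul_of]
  unfold HasExp at *
  simp only [AddEquiv.symm_apply_apply] at *
  have ht : algebraMap k[X] B Polynomial.X = algebraMap (RatFunc k) B RatFunc.X := by
    rw [IsScalarTower.algebraMap_apply k[X] (RatFunc k) B, RatFunc.algebraMap_X]
  have h1 := HasSum.mul_left (algebraMap k[X] B Polynomial.X) h
  let : Algebra k B := Algebra.compHom B (Polynomial.C : k →+* k[X])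
  have h2 : HasSum (fun i => (expCoeff k i • x ^ Fintype.card k ^ i) ^ Fintype.card k)
      (y ^ Fintype.card k) :=
    HasSum.map h (FiniteField.frobeniusAlgHom k B : B →ₐ[k] B) (continuous_pow _)
  have h3 : HasSum (fun i : ℕ => if i = 0 then 0 else
      (expCoeff k (i - 1) • x ^ Fintype.card k ^ (i - 1)) ^ Fintype.card k)
      (y ^ Fintype.card k) := by
    rw [← hasSum_nat_add_iff' 1]
    simpa using h2
  refine (congrArg (HasSum · _) (funext fun i => ?_)).mp (h1.add h3)
  rw [Algebra.smul_def Polynomial.X x, mul_pow, ht]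
  cases i with
  | zero => simp [expCoeff]
  | succ i =>
    simp only [Nat.add_eq_zero_iff, one_ne_zero, and_false, if_false, Nat.add_sub_cancel]
    rw [Algebra.smul_def, Algebra.smul_def, Algebra.smul_def, mul_pow, ← pow_mul, ← pow_succ,
      ← mul_assoc, ← mul_assoc, ← map_pow, ← map_mul, ← map_pow, ← map_mul, ← add_mul,
      ← map_add, expCoeff_succ]

/-- The relation `exp_E(x) = y` is `k[t]`-linear. -/
theorem HasExp.smul {x : B} {y : Points k B} (p : k[X]) (h : HasExp x y) :
    HasExp (p • x) (p • y) := by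
  induction p using Polynomial.induction_on with
  | C a => exact h.C_smul a
  | add p q hp hq => simpa only [add_smul] using hp.add hq
  | monomial n a hn =>
    rw [pow_succ', mul_left_comm, mul_smul, mul_smul (Polynomial.X : k[X])]
    exact hn.X_smul

end

end Exponential

/-! ### The monic generator of the Fitting ideal of a `k[t]`-module -/

/-- The (zeroth) Fitting ideal of a module `M`: the ideal generated by the determinants of all
square matrices whose rows are relations between the members of a finite generating family. -/
def fittingIdeal (A M : Type*) [CommRing A] [AddCommGroup M] [Module A M] : Ideal A :=
  Ideal.span {d | ∃ (n : ℕ) (g : Fin n → M) (P : Matrix (Fin n) (Fin n) A),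
    Submodule.span A (Set.range g) = ⊤ ∧ (∀ i, ∑ j, P i j • g j = 0) ∧ P.det = d}

/-- The polynomial `|M| ∈ k[t]`: the monic generator of the Fitting ideal of `M`. -/
def fittingCard (k M : Type*) [Field k] [AddCommGroup M] [Module k[X] M] : k[X] :=
  let g := Submodule.IsPrincipal.generator (fittingIdeal k[X] M)
  Polynomial.C g.leadingCoeff⁻¹ * g

/-! ### The period lattice, its Galois cohomology and the regulator -/

section Main

variable (k : Type*) [Field k] [DecidableEq (RatFunc k)]
variable (K : Type*) [Field K] [Algebra (RatFunc k) K]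

/-- `K_∞ = k((1/t)) ⊗ K`, the tensor product being over `k(t)`. -/
def KInf : Type _ := KInfty k ⊗[RatFunc k] K

instance : CommRing (KInf k K) := inferInstanceAs (CommRing (KInfty k ⊗[RatFunc k] K))

instance : Algebra (KInfty k) (KInf k K) :=
  inferInstanceAs (Algebra (KInfty k) (KInfty k ⊗[RatFunc k] K))

instance : Algebra (RatFunc k) (KInf k K) :=
  inferInstanceAs (Algebra (RatFunc k) (KInfty k ⊗[RatFunc k] K))

instance : IsScalarTower (RatFunc k) (KInfty k) (KInf k K) :=
  inferInstanceAs (IsScalarTower (RatFunc k) (KInfty k) (KInfty k ⊗[RatFunc k] K))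

instance : Algebra k[X] (KInf k K) :=
  ((algebraMap (RatFunc k) (KInf k K)).comp (algebraMap k[X] (RatFunc k))).toAlgebra

instance : IsScalarTower k[X] (RatFunc k) (KInf k K) := .of_algebraMap_eq fun _ => rfl

instance : IsScalarTower k[X] (KInfty k) (KInf k K) := .of_algebraMap_eq fun p => by
  rw [IsScalarTower.algebraMap_apply k[X] (RatFunc k) (KInf k K),
    IsScalarTower.algebraMap_apply k[X] (RatFunc k) (KInfty k),
    ← IsScalarTower.algebraMap_apply (RatFunc k) (KInfty k) (KInf k K)]

instance [FiniteDimensional (RatFunc k) K] : Module.Finite (KInfty k) (KInf k K) :=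
  inferInstanceAs (Module.Finite (KInfty k) (KInfty k ⊗[RatFunc k] K))

/-- `K_∞` has its topology as a finite-dimensional vector space over `k((1/t))`. -/
instance : TopologicalSpace (KInf k K) := moduleTopology (KInfty k) (KInf k K)

instance : IsModuleTopology (KInfty k) (KInf k K) := ⟨rfl⟩

instance [FiniteDimensional (RatFunc k) K] : IsTopologicalRing (KInf k K) :=
  IsModuleTopology.isTopologicalRing (KInfty k) (KInf k K)

/-- `K_∞^sep = k((1/t))^sep ⊗ K`, the tensor product being over `k(t)`. -/
def KInfSep : Type _ := KSep k ⊗[RatFunc k] K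

instance : CommRing (KInfSep k K) := inferInstanceAs (CommRing (KSep k ⊗[RatFunc k] K))

instance : Algebra (KSep k) (KInfSep k K) :=
  inferInstanceAs (Algebra (KSep k) (KSep k ⊗[RatFunc k] K))

instance : Algebra (RatFunc k) (KInfSep k K) :=
  inferInstanceAs (Algebra (RatFunc k) (KSep k ⊗[RatFunc k] K))

instance : IsScalarTower (RatFunc k) (KSep k) (KInfSep k K) :=
  inferInstanceAs (IsScalarTower (RatFunc k) (KSep k) (KSep k ⊗[RatFunc k] K))

instance : Algebra k[X] (KInfSep k K) :=
  ((algebraMap (RatFunc k) (KInfSep k K)).comp (algebraMap k[X] (RatFunc k))).toAlgebra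

instance : IsScalarTower k[X] (RatFunc k) (KInfSep k K) := .of_algebraMap_eq fun _ => rfl

instance : IsScalarTower k[X] (KSep k) (KInfSep k K) := .of_algebraMap_eq fun p => by
  rw [IsScalarTower.algebraMap_apply k[X] (RatFunc k) (KInfSep k K),
    IsScalarTower.algebraMap_apply k[X] (RatFunc k) (KSep k),
    ← IsScalarTower.algebraMap_apply (RatFunc k) (KSep k) (KInfSep k K)]

instance [FiniteDimensional (RatFunc k) K] : Module.Finite (KSep k) (KInfSep k K) :=
  inferInstanceAs (Module.Finite (KSep k) (KSep k ⊗[RatFunc k] K))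

/-- `K_∞^sep` has its topology as a finite-dimensional vector space over `k((1/t))^sep`. -/
instance : TopologicalSpace (KInfSep k K) := moduleTopology (KSep k) (KInfSep k K)

instance : IsModuleTopology (KSep k) (KInfSep k K) := ⟨rfl⟩

instance [FiniteDimensional (RatFunc k) K] : IsTopologicalRing (KInfSep k K) :=
  IsModuleTopology.isTopologicalRing (KSep k) (KInfSep k K)

/-- The inclusion `K → K_∞`. -/
def ofField : K →ₐ[RatFunc k] KInf k K :=
  (Algebra.TensorProduct.includeRight : K →ₐ[RatFunc k] KInfty k ⊗[RatFunc k] K)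

theorem isBaseChange_ofField : IsBaseChange (KInfty k) (ofField k K).toLinearMap :=
  (TensorProduct.isBaseChange (RatFunc k) K (KInfty k) :)

/-- The inclusion `K_∞ → K_∞^sep`. -/
def toSep : KInf k K →ₐ[RatFunc k] KInfSep k K :=
  (Algebra.TensorProduct.map (IsScalarTower.toAlgHom (RatFunc k) (KInfty k) (KSep k))
    (AlgHom.id (RatFunc k) K) : KInfty k ⊗[RatFunc k] K →ₐ[RatFunc k] KSep k ⊗[RatFunc k] K)

/-- The Galois group `G` of `k((1/t))^sep` over `k((1/t))`, with its Krull topology. -/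
abbrev Gal : Type _ := KSep k ≃ₐ[KInfty k] KSep k

variable {k} in
/-- The action of `G` on `K_∞^sep` through the first tensor factor. -/
def galAct (σ : Gal k) : KInfSep k K →ₐ[RatFunc k] KInfSep k K :=
  (Algebra.TensorProduct.map ((σ : KSep k →ₐ[KInfty k] KSep k).restrictScalars (RatFunc k))
    (AlgHom.id (RatFunc k) K) : KSep k ⊗[RatFunc k] K →ₐ[RatFunc k] KSep k ⊗[RatFunc k] K)

variable {k K} in
theorem galAct_smul (σ : Gal k) (p : k[X]) (x : KInfSep k K) :
    galAct K σ (p • x) = p • galAct K σ x := by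
  rw [← IsScalarTower.algebraMap_smul (RatFunc k) p x, map_smul,
    IsScalarTower.algebraMap_smul]

variable {k K} in
theorem toSep_smul (p : k[X]) (x : KInf k K) : toSep k K (p • x) = p • toSep k K x := by
  rw [← IsScalarTower.algebraMap_smul (RatFunc k) p x, map_smul,
    IsScalarTower.algebraMap_smul]

variable [Fintype k] [FiniteDimensional (RatFunc k) K]

/-- The period lattice `Λ_E`, the kernel of `exp_E : Lie_E(K_∞^sep) → E(K_∞^sep)`. -/
def periodLattice : Submodule k[X] (KInfSep k K) where
  carrier := {x | HasExp x (0 : Points k (KInfSep k K))}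
  add_mem' hx hy := by simpa using HasExp.add hx hy
  zero_mem' := HasExp.zero
  smul_mem' p x hx := by simpa using HasExp.smul p hx

/-- Continuous 1-cocycles of `G` with values in the discrete module `Λ_E`. -/
def cocycles : Submodule k[X] (Gal k → KInfSep k K) where
  carrier := {c | IsLocallyConstant c ∧ (∀ σ, c σ ∈ periodLattice k K) ∧
    ∀ σ τ, c (σ * τ) = c σ + galAct K σ (c τ)}
  add_mem' {c d} hc hd := ⟨hc.1.add hd.1, fun σ => add_mem (hc.2.1 σ) (hd.2.1 σ), fun σ τ => by
    simp only [Pi.add_apply, hc.2.2, hd.2.2, map_add]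
    abel⟩
  zero_mem' := ⟨IsLocallyConstant.const 0, fun _ => zero_mem _, fun σ τ => by simp⟩
  smul_mem' p c hc := ⟨hc.1.comp (p • ·), fun σ => Submodule.smul_mem _ p (hc.2.1 σ), fun σ τ => by
    simp only [Pi.smul_apply, hc.2.2, galAct_smul, smul_add]⟩

/-- The 1-coboundaries `σ ↦ σ l - l` with `l ∈ Λ_E`. -/
def coboundaries : Submodule k[X] (cocycles k K) where
  carrier := {c | ∃ l ∈ periodLattice k K, ∀ σ, c.1 σ = galAct K σ l - l}
  add_mem' := by
    rintro c d ⟨l, hl', hl⟩ ⟨m, hm', hm⟩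
    refine ⟨l + m, add_mem hl' hm', fun σ => ?_⟩
    simp only [Submodule.coe_add, Pi.add_apply, hl, hm, map_add]
    abel
  zero_mem' := ⟨0, zero_mem _, fun σ => by simp⟩
  smul_mem' := by
    rintro p c ⟨l, hl', hl⟩
    exact ⟨p • l, Submodule.smul_mem _ p hl', fun σ => by
      simp only [Submodule.coe_smul, Pi.smul_apply, hl, galAct_smul, smul_sub]⟩

/-- The Galois cohomology group `H¹(G, Λ_E)`. -/
abbrev H1 : Type _ := cocycles k K ⧸ coboundaries k K

/-- The `k[t]`-linear map `E(K_∞) → E(K_∞^sep)`. -/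
def pointsToSep : Points k (KInf k K) →ₗ[k[X]] Points k (KInfSep k K) :=
  Points.map ((toSep k K).restrictScalars k[X])

/-- The graph of the connecting map `E(K_∞) → H¹(G, Λ_E)`: a point `y` is sent to the class of
the cocycle `σ ↦ σ x - x`, for any `x ∈ Lie_E(K_∞^sep)` with `exp_E(x) = y`. -/
def connectingGraph : Submodule k[X] (Points k (KInf k K) × H1 k K) where
  carrier := {yc | ∃ (z : cocycles k K) (x : KInfSep k K), Submodule.Quotient.mk z = yc.2 ∧
    HasExp x (pointsToSep k K yc.1) ∧ ∀ σ, z.1 σ = galAct K σ x - x}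
  add_mem' := by
    rintro ⟨y, _⟩ ⟨y', _⟩ ⟨z, x, rfl, hx, hz⟩ ⟨z', x', rfl, hx', hz'⟩
    refine ⟨z + z', x + x', rfl, by simpa using hx.add hx', fun σ => ?_⟩
    simp only [Submodule.coe_add, Pi.add_apply, hz, hz', map_add]
    abel
  zero_mem' := ⟨0, 0, rfl, by simpa using HasExp.zero, fun σ => by simp⟩
  smul_mem' := by
    rintro p ⟨y, _⟩ ⟨z, x, rfl, hx, hz⟩
    refine ⟨p • z, p • x, rfl, by simpa using hx.smul p, fun σ => ?_⟩
    simp only [Submodule.coe_smul, Pi.smul_apply, hz, galAct_smul, smul_sub]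

variable [Algebra k[X] K] [IsScalarTower k[X] (RatFunc k) K]

/-- The ring `R`, the integral closure of `k[t]` in `K`. -/
abbrev IntegralRing : Type _ := FunctionField.ringOfIntegers k K

/-- The inclusion `R → K_∞`. -/
def ringToInf : IntegralRing k K →ₐ[k[X]] KInf k K :=
  ((ofField k K).restrictScalars k[X]).comp (FunctionField.ringOfIntegers k K).val

/-- The inclusion `E(R) → E(K_∞)`. -/
def integralPoints : Points k (IntegralRing k K) →ₗ[k[X]] Points k (KInf k K) :=
  Points.map (ringToInf k K)

/-- The image of `E(R)` under the connecting map `E(K_∞) → H¹(G, Λ_E)`. -/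
def integralImage : Submodule k[X] (H1 k K) where
  carrier := {c | ∃ r, (integralPoints k K r, c) ∈ connectingGraph k K}
  add_mem' := by
    rintro c d ⟨r, hr⟩ ⟨s, hs⟩
    exact ⟨r + s, by simpa using add_mem hr hs⟩
  zero_mem' := ⟨0, by rw [map_zero]; exact zero_mem (connectingGraph k K)⟩
  smul_mem' := by
    rintro p c ⟨r, hr⟩
    exact ⟨p • r, by simpa using Submodule.smul_mem _ p hr⟩

/-- `H_R`, the cokernel of `E(R) → H¹(G, Λ_E)`. -/
abbrev HR : Type _ := H1 k K ⧸ integralImage k K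

/-- The inverse image `exp_E⁻¹(E(R))` in `Lie_E(K_∞)`. -/
def expInv : Submodule k[X] (KInf k K) where
  carrier := {x | ∃ r, HasExp x (integralPoints k K r)}
  add_mem' := by
    rintro x y ⟨r, hr⟩ ⟨s, hs⟩
    exact ⟨r + s, by simpa using hr.add hs⟩
  zero_mem' := ⟨0, by simpa using HasExp.zero⟩
  smul_mem' := by
    rintro p x ⟨r, hr⟩
    exact ⟨p • r, by simpa using hr.smul p⟩

theorem isBaseChange_ringToInf :
    IsBaseChange (KInfty k) (ringToInf k K).toLinearMap := by
  have : IsLocalization (Algebra.algebraMapSubmonoid (IntegralRing k K) (nonZeroDivisors k[X])) K :=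
    IsIntegralClosure.isLocalization k[X] (RatFunc k) K (IntegralRing k K)
  have : IsLocalizedModule (nonZeroDivisors k[X])
      (IsScalarTower.toAlgHom k[X] (IntegralRing k K) K).toLinearMap :=
    isLocalizedModule_iff_isLocalization.mpr this
  have h1 : IsBaseChange (RatFunc k) (IsScalarTower.toAlgHom k[X] (IntegralRing k K) K).toLinearMap :=
    IsLocalizedModule.isBaseChange (nonZeroDivisors k[X]) (RatFunc k) _
  have h2 := h1.comp (isBaseChange_ofField k K)
  have h3 : (ringToInf k K).toLinearMap = ((ofField k K).toLinearMap.restrictScalars k[X]) ∘ₗ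
      (IsScalarTower.toAlgHom k[X] (IntegralRing k K) K).toLinearMap := LinearMap.ext fun _ => rfl
  rw [h3]
  exact h2

/-- The isomorphism `k((1/t)) ⊗ Lie_E(R) ≃ Lie_E(K_∞)`, the tensor product being over `k[t]`. -/
def lieEquiv : KInfty k ⊗[k[X]] IntegralRing k K ≃ₗ[KInfty k] KInf k K :=
  (isBaseChange_ringToInf k K).equiv

/-- The map `ρ : k((1/t)) ⊗ exp_E⁻¹(E(R)) → k((1/t)) ⊗ Lie_E(R)` induced by the inclusion of
`exp_E⁻¹(E(R))` in `Lie_E(K_∞)`. -/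
def rho : KInfty k ⊗[k[X]] expInv k K →ₗ[KInfty k] KInfty k ⊗[k[X]] IntegralRing k K :=
  (lieEquiv k K).symm.toLinearMap ∘ₗ LinearMap.liftBaseChange (KInfty k) (expInv k K).subtype

variable {k} in
/-- An element of `k((1/t))` is monic if its leading term is `t ^ n` for some integer `n`. -/
def IsMonic (f : KInfty k) : Prop :=
  ∃ n : ℤ, Valued.v (f - algebraMap (RatFunc k) (KInfty k) RatFunc.X ^ n) <
    (Valued.v (algebraMap (RatFunc k) (KInfty k) RatFunc.X ^ n) : ℤᵐ⁰)

/-- `r` is the regulator of `R`: the monic representative of the class in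
`k((1/t))ˣ / k[t]ˣ` of the determinant of `ρ` with respect to `k[t]`-bases of `exp_E⁻¹(E(R))` and
of `Lie_E(R)`. -/
def IsRegulator (r : KInfty k) : Prop :=
  IsMonic r ∧ ∃ (n : ℕ) (b : Module.Basis (Fin n) k[X] (expInv k K))
    (c : Module.Basis (Fin n) k[X] (IntegralRing k K)) (u : k[X]ˣ),
    r = (u : k[X]) • (LinearMap.toMatrix (b.baseChange (KInfty k)) (c.baseChange (KInfty k))
      (rho k K)).det

end Main

end Carlitz

end

/-!
# The class number formula for the Carlitz module

Write `F = k((1/t))`, `q = #k`, and `exp` for the exponential of the Carlitz module. Since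
`|e_i| = |t| ^ (-i q ^ i)`, the exponential series converges on every finite-dimensional
`F`-algebra and is dominated there by its linear term on small balls; hence it is an isometric
bijection from every sufficiently small ball to itself (`ExpSum.norm_sub_le`,
`exists_expSum_of_norm_le`, `exists_radius`). On `K_∞^sep` it is applied to an element inside the
finite-dimensional, hence complete, algebra generated by that element, so `K_∞^sep` itself need not
be complete.

The exponential is surjective on `K_∞^sep` (`exists_expSum_of_finite_isSepClosed`): over a
separably closed field, elements `y` with `|y| ≤ |t|` lie in the ball of isometry, and all others
are reached by solving the separable equations `t b + b ^ q = y`. As `K / k(t)` may be inseparable,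
`K_∞^sep` may have nilpotents; on these the exponential is a unipotent polynomial map. Surjectivity
makes the connecting map well defined. Galois descent shows that its kernel is `exp(K_∞)`, and the
additive form of Hilbert's Theorem 90 (`exists_eq_sub_of_cocycle`) that it is surjective.
Therefore `H_R` is the quotient of `K_∞` by `R + exp(K_∞)` (`card_HR`).

Let `U = exp⁻¹(R)`, a `k[t]`-submodule of `K_∞`, and let `B` be a small box, that is, the set of
vectors with coordinates of positive valuation in some basis. As `exp` maps `B` bijectively to
itself, it induces an embedding of `K_∞ / (U + B)` into `K_∞ / (R + B)` with cokernel `H_R`. The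
second group is finite, because `R` contains a basis of `K_∞`, so
`[K_∞ : R + B] = [K_∞ : U + B] · #H_R`. Both `R` and `U` meet `B` in `0`; for `R` this is the
discreteness of `R` in `K_∞`, which follows from the integrality of norms and needs no trace form
(`exists_radius_ringLattice`).

A `k[t]`-submodule `Λ` that meets `B` in `0`, with `Λ + B` of finite index, is a lattice, and the
index is `q ^ m`, where `-m` is the valuation of the determinant of a basis of `Λ` relative to the
box (`exists_basis_of_index_ne_zero`). Indeed, as long as `Λ + B` is not everything, some vector of
the basis of the box can be multiplied by `t` in such a way that the box still meets `Λ` in `0`,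
which divides the index by `q`; and if `Λ` and the box are complements, then the components in `Λ`
of the basis of the box form a basis of `Λ` with determinant of valuation `0`. For `R` and `U` this
says that both are free of rank `[K : k(t)]` and that the determinant of `ρ` has valuation
`dim_k H_R` (`exists_bases`).

Finally, the Fitting ideal of a `k[t]`-module of finite dimension over `k` is generated by the
characteristic polynomial of `t` (`fittingIdeal_eq_span_charpoly`), so `|H_R|` has degree
`dim_k H_R`.
-/

noncomputable section

namespace Carlitz

/-! ### The Fitting ideal of a finite-dimensional `k[t]`-module -/

section Fitting

open Polynomial
open scoped Matrix

variable {k M : Type*} [Field k] [AddCommGroup M] [Module k M] [Module k[X] M]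
  [IsScalarTower k k[X] M]

/-- Multiplication by `t`, as a `k`-linear endomorphism of a `k[t]`-module. -/
def mulX (k M : Type*) [Field k] [AddCommGroup M] [Module k M] [Module k[X] M]
    [IsScalarTower k k[X] M] : Module.End k M :=
  Algebra.lsmul k k M (X : k[X])

theorem mulX_apply (m : M) : mulX k M m = (X : k[X]) • m := rfl

theorem C_smul_eq (a : k) (m : M) : (C a : k[X]) • m = a • m := by
  rw [← smul_one_smul k[X] a m, Polynomial.smul_eq_C_mul, mul_one]

variable {ι : Type*} [Fintype ι] [DecidableEq ι]

theorem sum_charmatrix_smul (b : Module.Basis ι k M) (i : ι) :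
    ∑ j, ((LinearMap.toMatrix b b (mulX k M)).charmatrix)ᵀ i j • b j = 0 := by
  have h : (X : k[X]) • b i = ∑ j, C (LinearMap.toMatrix b b (mulX k M) j i) • b j := by
    simp_rw [C_smul_eq]
    rw [← mulX_apply]
    conv_lhs => rw [← b.sum_repr (mulX k M (b i))]
    simp [LinearMap.toMatrix_apply]
  simp only [Matrix.transpose_apply, Matrix.charmatrix, Matrix.sub_apply, Matrix.scalar_apply,
    sub_smul, Finset.sum_sub_distrib, Matrix.diagonal_apply, RingHom.mapMatrix_apply,
    Matrix.map_apply, ite_smul, zero_smul, Finset.sum_ite_eq', Finset.mem_univ, if_true]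
  rw [h, sub_self]

/-- Modulo the rows of `t - A`, where `A` is the matrix of `t` in a `k`-basis, every relation
between the basis vectors becomes one with constant coefficients, hence trivial. -/
theorem exists_vecMul_charmatrix (b : Module.Basis ι k M) (v : ι → k[X])
    (hv : ∑ j, v j • b j = 0) :
    ∃ y : ι → k[X], Matrix.vecMul y ((LinearMap.toMatrix b b (mulX k M)).charmatrix)ᵀ = v := by
  set T := ((LinearMap.toMatrix b b (mulX k M)).charmatrix)ᵀ with hT
  have hmod : ∀ v : ι → k[X],
      ∃ (y : ι → k[X]) (c : ι → k), v = Matrix.vecMul y T + fun j => C (c j) := by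
    have hadd : ∀ v w : ι → k[X],
        (∃ (y : ι → k[X]) (c : ι → k), v = Matrix.vecMul y T + fun j => C (c j)) →
        (∃ (y : ι → k[X]) (c : ι → k), w = Matrix.vecMul y T + fun j => C (c j)) →
        ∃ (y : ι → k[X]) (c : ι → k), v + w = Matrix.vecMul y T + fun j => C (c j) := by
      rintro v w ⟨y, c, rfl⟩ ⟨y', c', rfl⟩
      refine ⟨y + y', c + c', ?_⟩
      rw [Matrix.add_vecMul]
      ext1 j
      simp only [Pi.add_apply, map_add]
      ring
    have hX : ∀ v : ι → k[X],
        (∃ (y : ι → k[X]) (c : ι → k), v = Matrix.vecMul y T + fun j => C (c j)) →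
        ∃ (y : ι → k[X]) (c : ι → k), (X : k[X]) • v = Matrix.vecMul y T + fun j => C (c j) := by
      rintro v ⟨y, c, rfl⟩
      refine ⟨(X : k[X]) • y + fun j => C (c j),
        fun i => ∑ j, c j * LinearMap.toMatrix b b (mulX k M) i j, ?_⟩
      rw [Matrix.add_vecMul, Matrix.smul_vecMul, smul_add, add_assoc]
      congr 1
      ext1 i
      simp only [Pi.smul_apply, Pi.add_apply, Matrix.vecMul, dotProduct, hT,
        Matrix.transpose_apply, Matrix.charmatrix, Matrix.sub_apply, Matrix.scalar_apply,
        Matrix.diagonal_apply, RingHom.mapMatrix_apply, Matrix.map_apply, mul_sub, mul_ite,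
        mul_zero, Finset.sum_sub_distrib, Finset.sum_ite_eq, Finset.mem_univ, if_true, map_sum,
        map_mul, smul_eq_mul]
      ring
    have hsingle : ∀ (p : k[X]) (i : ι), ∃ (y : ι → k[X]) (c : ι → k),
        Pi.single i p = Matrix.vecMul y T + fun j => C (c j) := by
      intro p i
      induction p using Polynomial.induction_on with
      | C a =>
        refine ⟨0, Pi.single i a, ?_⟩
        rw [Matrix.zero_vecMul, zero_add]
        ext1 j
        by_cases h : j = i
        · subst h; simp
        · simp [h]
      | add p q hp hq => rw [Pi.single_add]; exact hadd _ _ hp hq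
      | monomial n a hn =>
        have : Pi.single i (C a * X ^ (n + 1)) =
            (X : k[X]) • (Pi.single i (C a * X ^ n) : ι → k[X]) := by
          rw [← Pi.single_smul, smul_eq_mul]
          congr 1
          ring
        rw [this]
        exact hX _ hn
    intro v
    rw [← Finset.univ_sum_single v]
    induction (Finset.univ : Finset ι) using Finset.induction_on with
    | empty => exact ⟨0, 0, by ext1; simp⟩
    | insert a s ha ih =>
      rw [Finset.sum_insert ha]
      exact hadd _ _ (hsingle _ _) ih
  obtain ⟨y, c, rfl⟩ := hmod v
  have h0 : ∑ j, (Matrix.vecMul y T) j • b j = 0 := by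
    simp only [Matrix.vecMul, dotProduct, Finset.sum_smul, mul_smul]
    rw [Finset.sum_comm]
    refine Finset.sum_eq_zero fun i _ => ?_
    rw [← Finset.smul_sum, sum_charmatrix_smul, smul_zero]
  have hc : ∑ j, c j • b j = 0 := by
    simpa [add_smul, Finset.sum_add_distrib, h0, C_smul_eq] using hv
  have hc0 : c = 0 := funext (Fintype.linearIndependent_iff.mp b.linearIndependent c hc)
  refine ⟨y, ?_⟩
  ext1 j
  simp [hc0]

/-- The characteristic polynomial of `t` divides every determinant of relations `P`: extend the
generating family `g` by the `k`-basis `b`, without changing the determinant, and express the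
relations obtained in this way by the complete system of relations `g = D b`, `(t - A) b = 0`. -/
theorem charpoly_dvd_det (b : Module.Basis ι k M) {n : ℕ} (g : Fin n → M)
    (P : Matrix (Fin n) (Fin n) k[X]) (hg : Submodule.span k[X] (Set.range g) = ⊤)
    (hP : ∀ i, ∑ j, P i j • g j = 0) :
    (LinearMap.toMatrix b b (mulX k M)).charpoly ∣ P.det := by
  set T := ((LinearMap.toMatrix b b (mulX k M)).charmatrix)ᵀ with hT
  have hC : ∀ i, ∃ c : Fin n → k[X], ∑ j, c j • g j = b i := fun i => by
    rw [← Submodule.mem_span_range_iff_exists_fun, hg]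
    trivial
  choose Cm hCm using hC
  let D : Matrix (Fin n) ι k[X] := fun j i => C (b.repr (g j) i)
  have hD : ∀ j, ∑ i, D j i • b i = g j := fun j => by
    simp only [D, C_smul_eq]
    exact b.sum_repr _
  let Q : Matrix (Fin n ⊕ ι) (Fin n ⊕ ι) k[X] := Matrix.fromBlocks 1 (-D) 0 T
  let S : Matrix (Fin n ⊕ ι) (Fin n ⊕ ι) k[X] := Matrix.fromBlocks P 0 (-(Matrix.of Cm)) 1
  have hrow : ∀ s, ∃ z, Matrix.vecMul z Q = S s := by
    intro s
    have hs : ∑ j, S s (Sum.inl j) • g j + ∑ i, S s (Sum.inr i) • b i = 0 := by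
      cases s with
      | inl i => simp [S, hP]
      | inr i => simp [S, hCm, Matrix.one_apply]
    obtain ⟨y, hy⟩ := exists_vecMul_charmatrix b
      (fun i => S s (Sum.inr i) + ∑ j, S s (Sum.inl j) * D j i) (by
        rw [← hs]
        simp only [add_smul, Finset.sum_add_distrib, Finset.sum_smul, mul_smul]
        rw [add_comm, Finset.sum_comm]
        simp only [← Finset.smul_sum, hD])
    refine ⟨Sum.elim (fun j => S s (Sum.inl j)) y, ?_⟩
    rw [Matrix.vecMul_fromBlocks]
    ext1 x
    cases x with
    | inl j => simp [Function.comp_def]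
    | inr i =>
      simp only [Sum.elim_inr, Pi.add_apply, Sum.elim_comp_inr, ← hT] at hy ⊢
      rw [hy]
      simp [Matrix.vecMul, dotProduct]
  choose Z hZ using hrow
  have hSZ : S = Matrix.of Z * Q := by
    refine funext fun s => ?_
    rw [← hZ s]
    rfl
  have hdet : P.det = (Matrix.of Z).det * T.det := by
    have h1 : S.det = P.det := by simp [S]
    have h2 : Q.det = T.det := by simp [Q]
    rw [← h1, ← h2, hSZ, Matrix.det_mul]
  rw [hdet, hT, Matrix.det_transpose]
  exact Dvd.intro_left _ rfl

theorem fittingIdeal_eq_span_charpoly [Module.Finite k M] :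
    fittingIdeal k[X] M = Ideal.span {(mulX k M).charpoly} := by
  let b := Module.finBasis k M
  rw [← (mulX k M).charpoly_toMatrix b]
  refine le_antisymm (Ideal.span_le.mpr ?_) (Ideal.span_mono ?_)
  · rintro _ ⟨n, g, P, hg, hP, rfl⟩
    exact Ideal.mem_span_singleton.mpr (charpoly_dvd_det b g P hg hP)
  · rw [Set.singleton_subset_iff]
    refine ⟨_, b, _, ?_, sum_charmatrix_smul b, Matrix.det_transpose _⟩
    rw [eq_top_iff]
    intro x _
    have h : x ∈ Submodule.span k (Set.range b) := b.span_eq.symm ▸ Submodule.mem_top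
    exact Submodule.span_le_restrictScalars k k[X] _ h

theorem natDegree_fittingCard [Module.Finite k M] :
    fittingCard k M ≠ 0 ∧ (fittingCard k M).natDegree = Module.finrank k M := by
  set c := (mulX k M).charpoly
  have hc : c ≠ 0 := (LinearMap.charpoly_monic _).ne_zero
  set g := Submodule.IsPrincipal.generator (fittingIdeal k[X] M) with hgdef
  have hg : Associated g c := by
    rw [← Ideal.span_singleton_eq_span_singleton, ← fittingIdeal_eq_span_charpoly]
    exact Ideal.span_singleton_generator _
  have hg0 : g ≠ 0 := fun h => hc ((hg.eq_zero_iff).mp h)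
  have hl : g.leadingCoeff⁻¹ ≠ 0 := inv_ne_zero (leadingCoeff_ne_zero.mpr hg0)
  refine ⟨mul_ne_zero (C_ne_zero.mpr hl) hg0, ?_⟩
  change (C g.leadingCoeff⁻¹ * g).natDegree = _
  rw [natDegree_C_mul hl, natDegree_eq_natDegree (degree_eq_degree_of_associated hg)]
  exact LinearMap.charpoly_natDegree _

/-- For a finite `k[t]`-module, viewed as a vector space over `k`, the cardinality and the degree
of the generator of the Fitting ideal are both given by the dimension. -/
theorem finite_module_card (k M : Type*) [Field k] [AddCommGroup M] [Module k[X] M] [Finite M] :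
    Nat.card M = Nat.card k ^ Module.finrank k (RestrictScalars k k[X] M) ∧
      fittingCard k M ≠ 0 ∧
      (fittingCard k M).natDegree = Module.finrank k (RestrictScalars k k[X] M) := by
  let _ : Module k M := Module.compHom M (algebraMap k k[X])
  have : IsScalarTower k k[X] M := .of_algebraMap_smul fun _ _ => rfl
  have : Module.Finite k M := Module.Finite.of_finite
  exact ⟨Module.natCard_eq_pow_finrank (K := k) (V := M), natDegree_fittingCard⟩

end Fitting

/-! ### Polynomial parts and lattices in vector spaces over `k((1/t))` -/

section Lattice

variable {k : Type*} [Field k] [DecidableEq (RatFunc k)]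

/-- The element `t` of `k((1/t))`. -/
def tInf (k : Type*) [Field k] [DecidableEq (RatFunc k)] : KInfty k :=
  algebraMap (RatFunc k) (KInfty k) RatFunc.X

theorem valued_tInf : Valued.v (tInf k) = WithZero.exp (1 : ℤ) := by
  rw [tInf, valued_algebraMap, RatFunc.inftyValuation.X]

theorem tInf_ne_zero : tInf k ≠ 0 := by
  rw [← (Valued.v : Valuation (KInfty k) ℤᵐ⁰).ne_zero_iff, valued_tInf]
  exact WithZero.exp_ne_zero

theorem algebraMap_X_eq_tInf : algebraMap k[X] (KInfty k) Polynomial.X = tInf k := by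
  rw [IsScalarTower.algebraMap_apply k[X] (RatFunc k) (KInfty k), RatFunc.algebraMap_X, tInf]

theorem valued_tInf_zpow (n : ℤ) : Valued.v (tInf k ^ n) = WithZero.exp n := by
  rw [map_zpow₀, valued_tInf, ← WithZero.exp_zsmul, smul_eq_mul, mul_one]

theorem valued_polynomial {p : k[X]} (hp : p ≠ 0) :
    Valued.v (algebraMap k[X] (KInfty k) p) = WithZero.exp (p.natDegree : ℤ) := by
  rw [IsScalarTower.algebraMap_apply k[X] (RatFunc k) (KInfty k), valued_algebraMap]
  exact RatFunc.inftyValuation.polynomial k hp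

theorem polynomial_eq_zero_of_valued_lt_one {p : k[X]}
    (hp : Valued.v (algebraMap k[X] (KInfty k) p) < 1) : p = 0 := by
  by_contra h
  rw [valued_polynomial h, ← WithZero.exp_zero, WithZero.exp_lt_exp] at hp
  omega

theorem valued_C_le_one (a : k) : Valued.v (algebraMap k[X] (KInfty k) (Polynomial.C a)) ≤ 1 := by
  by_cases h : a = 0
  · simp [h]
  · rw [valued_polynomial (Polynomial.C_ne_zero.mpr h), Polynomial.natDegree_C]
    simp

theorem norm_eq_toNNReal_valued (f : KInfty k) :
    ‖f‖ = (WithZeroMulInt.toNNReal (e := 2) two_ne_zero (Valued.v f) : ℝ) := by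
  rw [← Valuation.embedding_restrict Valued.v f]
  rfl

theorem norm_eq_zpow {f : KInfty k} {n : ℤ} (h : Valued.v f = WithZero.exp n) :
    ‖f‖ = 2 ^ n := by
  rw [norm_eq_toNNReal_valued, h, WithZeroMulInt.toNNReal_neg_apply _ WithZero.exp_ne_zero]
  push_cast
  rfl

/-- The norm of `k((1/t))` is normalized by `|t| = 2`, independently of `q`. -/
theorem norm_tInf : ‖tInf k‖ = 2 := by
  simpa using norm_eq_zpow (valued_tInf (k := k))

theorem norm_lt_one_iff {f : KInfty k} : ‖f‖ < 1 ↔ Valued.v f < 1 := by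
  rw [norm_eq_toNNReal_valued, ← NNReal.coe_one, NNReal.coe_lt_coe,
    WithZeroMulInt.toNNReal_lt_one_iff one_lt_two]

/-- Every element of `k((1/t))` is the sum of a polynomial in `t` and of an element of positive
valuation. -/
theorem exists_polynomial_part (f : KInfty k) :
    ∃ p : k[X], Valued.v (f - algebraMap k[X] (KInfty k) p) < 1 := by
  obtain ⟨r, hr⟩ : ∃ r : RatFunc k, Valued.v (f - algebraMap (RatFunc k) (KInfty k) r) < 1 := by
    have hd : DenseRange (algebraMap (RatFunc k) (KInfty k)) :=
      @UniformSpace.Completion.denseRange_coe (RatFunc k) (RatFunc.inftyValued k).toUniformSpace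
    obtain ⟨r, hr⟩ := Metric.denseRange_iff.mp hd f 1 one_pos
    exact ⟨r, norm_lt_one_iff.mp (by rwa [← dist_eq_norm])⟩
  have hden := r.denom_ne_zero
  refine ⟨r.num / r.denom, ?_⟩
  have hsplit : f - algebraMap k[X] (KInfty k) (r.num / r.denom) =
      (f - algebraMap (RatFunc k) (KInfty k) r) +
        algebraMap k[X] (KInfty k) (r.num % r.denom) / algebraMap k[X] (KInfty k) r.denom := by
    have h1 : algebraMap (RatFunc k) (KInfty k) r =
        algebraMap k[X] (KInfty k) r.num / algebraMap k[X] (KInfty k) r.denom := by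
      conv_lhs => rw [← RatFunc.num_div_denom r]
      rw [map_div₀, ← IsScalarTower.algebraMap_apply, ← IsScalarTower.algebraMap_apply]
    have h2 : algebraMap k[X] (KInfty k) r.denom ≠ 0 := by
      rw [← (Valued.v : Valuation (KInfty k) ℤᵐ⁰).ne_zero_iff, valued_polynomial hden]
      exact WithZero.exp_ne_zero
    have h3 := congrArg (algebraMap k[X] (KInfty k)) (EuclideanDomain.div_add_mod r.num r.denom)
    rw [map_add, map_mul] at h3
    rw [h1]
    field_simp
    rw [← h3]
    ring
  rw [hsplit]
  refine Valuation.map_add_lt _ hr ?_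
  by_cases h0 : r.num % r.denom = 0
  · simp [h0]
  rw [map_div₀, valued_polynomial h0, valued_polynomial hden, ← WithZero.exp_sub,
    ← WithZero.exp_zero, WithZero.exp_lt_exp]
  have := Polynomial.natDegree_lt_natDegree h0 (Polynomial.degree_mod_lt r.num hden)
  omega

/-- An element of nonnegative valuation has a constant term. -/
theorem exists_constant_part {f : KInfty k} (hf : Valued.v f ≤ 1) :
    ∃ a : k, Valued.v (f - algebraMap k[X] (KInfty k) (Polynomial.C a)) < 1 := by
  obtain ⟨p, hp⟩ := exists_polynomial_part f
  have h1 : Valued.v (algebraMap k[X] (KInfty k) p) ≤ 1 := by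
    have : algebraMap k[X] (KInfty k) p = f - (f - algebraMap k[X] (KInfty k) p) := by ring
    rw [this]
    exact Valuation.map_sub_le _ hf hp.le
  have h2 : p.natDegree = 0 := by
    by_cases h0 : p = 0
    · simp [h0]
    rw [valued_polynomial h0, ← WithZero.exp_zero, WithZero.exp_le_exp] at h1
    omega
  refine ⟨p.coeff 0, ?_⟩
  rwa [← Polynomial.eq_C_of_natDegree_eq_zero h2]

theorem polynomial_smul_eq {V : Type*} [AddCommGroup V] [Module (KInfty k) V] [Module k[X] V]
    [IsScalarTower k[X] (KInfty k) V] (p : k[X]) (v : V) :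
    p • v = algebraMap k[X] (KInfty k) p • v :=
  (algebraMap_smul (KInfty k) p v).symm

theorem algebraMap_polynomial_injective : Function.Injective (algebraMap k[X] (KInfty k)) := by
  rw [injective_iff_map_eq_zero]
  intro f hf
  exact polynomial_eq_zero_of_valued_lt_one (by rw [hf, map_zero]; exact zero_lt_one)

variable {V : Type*} [AddCommGroup V] [Module (KInfty k) V] {ι : Type*}

/-- The box `B_b` of a basis `b`: the vectors all of whose coordinates have positive valuation. -/
def box (b : Module.Basis ι (KInfty k) V) : AddSubgroup V where
  carrier := {v | ∀ i, Valued.v (b.repr v i) < (1 : ℤᵐ⁰)}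
  add_mem' {v w} hv hw i := by
    rw [map_add, Finsupp.add_apply]
    exact Valuation.map_add_lt _ (hv i) (hw i)
  zero_mem' i := by simp
  neg_mem' {v} hv i := by
    rw [map_neg, Finsupp.neg_apply, Valuation.map_neg]
    exact hv i

theorem mem_box {b : Module.Basis ι (KInfty k) V} {v : V} :
    v ∈ box b ↔ ∀ i, Valued.v (b.repr v i) < (1 : ℤᵐ⁰) := Iff.rfl

theorem smul_mem_box {b : Module.Basis ι (KInfty k) V} {v : V} (hv : v ∈ box b) {f : KInfty k}
    (hf : Valued.v f ≤ 1) : f • v ∈ box b := fun i => by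
  rw [map_smul, Finsupp.smul_apply, smul_eq_mul, map_mul]
  exact (mul_le_of_le_one_left' hf).trans_lt (hv i)

variable [Fintype ι] [DecidableEq ι] [Module k[X] V] [IsScalarTower k[X] (KInfty k) V]

/-- A matrix of integers that reduces to the identity in the residue field has determinant of
valuation `0`. -/
theorem det_one_add_valued {E : Matrix ι ι (KInfty k)}
    (hE : ∀ i j, Valued.v (E i j) < (1 : ℤᵐ⁰)) :
    Valued.v (1 + E).det = (1 : ℤᵐ⁰) := by
  let v : Valuation (KInfty k) ℤᵐ⁰ := Valued.v
  let O := v.valuationSubring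
  let E' : Matrix ι ι O := fun i j => ⟨E i j, (hE i j).le⟩
  have h1 : (1 + E).det = ((1 + E').det : O) := by
    change _ = O.subtype (1 + E').det
    rw [RingHom.map_det]
    congr 1
    rw [map_add, map_one]
    rfl
  have h2 : IsLocalRing.residue O (1 + E').det = 1 := by
    rw [RingHom.map_det, map_add, map_one]
    have : (IsLocalRing.residue O).mapMatrix E' = 0 := by
      ext i j
      change IsLocalRing.residue O (E' i j) = 0
      rw [IsLocalRing.residue_eq_zero_iff]
      exact (Valuation.mem_maximalIdeal_iff _ v).mpr (hE i j)
    rw [this, add_zero, Matrix.det_one]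
  rw [h1]
  refine le_antisymm (1 + E').det.2 (not_lt.mp fun h => ?_)
  rw [(IsLocalRing.residue_eq_zero_iff _).mpr ((Valuation.mem_maximalIdeal_iff _ v).mpr h)] at h2
  exact zero_ne_one h2

variable [Fintype k]

/-- Replacing one vector `b_j` of a basis by `t b_j`. -/
def stretch (b : Module.Basis ι (KInfty k) V) (j : ι) : Module.Basis ι (KInfty k) V :=
  b.unitsSMul (Function.update 1 j (Units.mk0 (tInf k) tInf_ne_zero))

theorem mem_box_stretch {b : Module.Basis ι (KInfty k) V} {j : ι} {v : V} :
    v ∈ box (stretch b j) ↔ ∃ a : k, v - (Polynomial.C a : k[X]) • b j ∈ box b := by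
  have hrepr : ∀ i, (stretch b j).repr v i = if i = j then (tInf k)⁻¹ * b.repr v i
      else b.repr v i := fun i => by
    rw [stretch, Module.Basis.repr_unitsSMul]
    by_cases h : i = j
    · subst h; simp [Units.smul_def]
    · simp [h]
  have hsub : ∀ (a : k) i, b.repr (v - (Polynomial.C a : k[X]) • b j) i =
      if i = j then b.repr v i - algebraMap k[X] (KInfty k) (Polynomial.C a) else b.repr v i := by
    intro a i
    rw [polynomial_smul_eq, map_sub, map_smul, Module.Basis.repr_self, Finsupp.sub_apply,
      Finsupp.smul_apply, Finsupp.single_apply]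
    by_cases h : i = j
    · subst h; simp
    · simp [h, Ne.symm h]
  have hval : ∀ f : KInfty k, Valued.v ((tInf k)⁻¹ * f) < (1 : ℤᵐ⁰) ↔ Valued.v f ≤ (1 : ℤᵐ⁰) := by
    intro f
    rw [map_mul, map_inv₀, valued_tInf]
    by_cases h0 : Valued.v f = (0 : ℤᵐ⁰)
    · simp [h0]
    rw [← WithZero.exp_log h0, ← WithZero.exp_neg, ← WithZero.exp_add, ← WithZero.exp_zero,
      WithZero.exp_lt_exp, WithZero.exp_le_exp]
    omega
  simp only [mem_box, hrepr, hsub]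
  constructor
  · intro h
    have hj := h j
    rw [if_pos rfl, hval] at hj
    obtain ⟨a, ha⟩ := exists_constant_part hj
    refine ⟨a, fun i => ?_⟩
    by_cases hi : i = j
    · subst hi; simpa using ha
    · simpa [hi] using h i
  · rintro ⟨a, ha⟩ i
    by_cases hi : i = j
    · subst hi
      rw [if_pos rfl, hval]
      have h := ha i
      rw [if_pos rfl] at h
      rw [← sub_add_cancel (b.repr v i) (algebraMap k[X] (KInfty k) (Polynomial.C a))]
      exact Valuation.map_add_le _ h.le (valued_C_le_one a)
    · simpa [hi] using ha i

/-- Stretching the box lowers the covolume of a lattice relative to it by one power of `t`. -/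
theorem valued_det_stretch (b : Module.Basis ι (KInfty k) V) (j : ι) (l : ι → V) :
    Valued.v (b.det l) = WithZero.exp 1 * (Valued.v ((stretch b j).det l) : ℤᵐ⁰) := by
  have : (∏ i, (Function.update 1 j (Units.mk0 (tInf k) tInf_ne_zero) : ι → (KInfty k)ˣ) i) =
      Units.mk0 (tInf k) tInf_ne_zero := by
    rw [Finset.prod_update_of_mem (Finset.mem_univ j)]
    simp
  have hdet : (stretch b j).det l = (tInf k)⁻¹ * b.det l := by
    rw [stretch, Module.Basis.det_unitsSMul, this]
    rfl
  rw [hdet, map_mul, map_inv₀, valued_tInf, mul_inv_cancel_left₀ WithZero.exp_ne_zero]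

/-- If `V` is the direct sum of a `k[t]`-submodule `U` and of the box of `b`, then the components
of the vectors `b_j` in `U` form a basis of `U`. -/
theorem exists_basis_of_isCompl (b : Module.Basis ι (KInfty k) V) (U : Submodule k[X] V)
    (hd : ∀ v ∈ U, v ∈ box b → v = 0) (hs : U.toAddSubgroup ⊔ box b = ⊤) :
    ∃ l : Module.Basis ι (KInfty k) V, Submodule.span k[X] (Set.range l) = U ∧
      Valued.v (b.det l) = (1 : ℤᵐ⁰) := by
  have hex : ∀ j, ∃ l ∈ U, b j - l ∈ box b := fun j => by
    obtain ⟨l, hl, c, hc, h⟩ := AddSubgroup.mem_sup.mp (hs.symm ▸ AddSubgroup.mem_top (b j))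
    exact ⟨l, hl, by rwa [← h, add_sub_cancel_left]⟩
  choose l hlU hlb using hex
  have hdet : Valued.v (b.det l) = (1 : ℤᵐ⁰) := by
    rw [Module.Basis.det_apply]
    have : b.toMatrix l = 1 + Matrix.of fun i j => - b.repr (b j - l j) i := by
      ext i j
      simp [Module.Basis.toMatrix_apply, Matrix.one_apply, Finsupp.single_apply, eq_comm]
    rw [this]
    refine det_one_add_valued fun i j => ?_
    rw [Matrix.of_apply, Valuation.map_neg]
    exact hlb j i
  have hunit : IsUnit (b.det l) := by
    rw [isUnit_iff_ne_zero, ← (Valued.v : Valuation (KInfty k) ℤᵐ⁰).ne_zero_iff, hdet]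
    exact one_ne_zero
  obtain ⟨hli, hsp⟩ := (Module.Basis.is_basis_iff_det b).mpr hunit
  refine ⟨Module.Basis.mk hli hsp.ge, ?_, by rwa [Module.Basis.coe_mk]⟩
  rw [Module.Basis.coe_mk]
  refine le_antisymm (Submodule.span_le.mpr (Set.range_subset_iff.mpr hlU)) fun v hv => ?_
  choose p hp using fun j => exists_polynomial_part ((Module.Basis.mk hli hsp.ge).repr v j)
  have hmem : ∑ j, p j • l j ∈ Submodule.span k[X] (Set.range l) :=
    Submodule.sum_mem _ fun j _ => Submodule.smul_mem _ _ (Submodule.subset_span ⟨j, rfl⟩)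
  have hle : Submodule.span k[X] (Set.range l) ≤ U :=
    Submodule.span_le.mpr (Set.range_subset_iff.mpr hlU)
  have hrep : ∀ i j, Valued.v (b.repr (l j) i) ≤ (1 : ℤᵐ⁰) := fun i j => by
    have h1 : b.repr (l j) i = b.repr (b j) i - b.repr (b j - l j) i := by
      rw [map_sub, Finsupp.sub_apply, sub_sub_cancel]
    rw [h1]
    refine Valuation.map_sub_le _ ?_ (hlb j i).le
    rw [Module.Basis.repr_self, Finsupp.single_apply]
    split_ifs <;> simp
  have hbox : v - ∑ j, p j • l j ∈ box b := by
    have h1 : v - ∑ j, p j • l j = ∑ j, ((Module.Basis.mk hli hsp.ge).repr v j -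
        algebraMap k[X] (KInfty k) (p j)) • l j := by
      conv_lhs => rw [← (Module.Basis.mk hli hsp.ge).sum_repr v]
      simp only [Module.Basis.coe_mk, sub_smul, Finset.sum_sub_distrib, polynomial_smul_eq]
    rw [h1]
    refine AddSubgroup.sum_mem _ fun j _ i => ?_
    rw [map_smul, Finsupp.smul_apply, smul_eq_mul, map_mul]
    exact (mul_le_of_le_one_right' (hrep i j)).trans_lt (hp j)
  have h0 := hd _ (U.sub_mem hv (hle hmem)) hbox
  rw [sub_eq_zero.mp h0]
  exact hmem

/-- A `k[t]`-submodule that meets a box in `0` and has finite index modulo that box is spanned by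
a basis of the vector space, whose covolume relative to the box is this index. The box is enlarged,
one vector at a time, until it becomes a complement. -/
theorem exists_basis_of_index_ne_zero (U : Submodule k[X] V) (n : ℕ) :
    ∀ (b : Module.Basis ι (KInfty k) V), (∀ v ∈ U, v ∈ box b → v = 0) →
      (U.toAddSubgroup ⊔ box b).index = n → n ≠ 0 →
    ∃ (l : Module.Basis ι (KInfty k) V) (m : ℕ), Submodule.span k[X] (Set.range l) = U ∧
      n = Fintype.card k ^ m ∧ Valued.v (b.det l) = WithZero.exp (m : ℤ) := by
  induction n using Nat.strong_induction_on with
  | _ n ih =>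
  intro b hd hn hn0
  set W := U.toAddSubgroup ⊔ box b with hW
  have hUW : ∀ u ∈ U, u ∈ W := fun u hu => AddSubgroup.mem_sup_left hu
  have hBW : ∀ u ∈ box b, u ∈ W := fun u hu => AddSubgroup.mem_sup_right hu
  have hC : ∀ (a : k), ∀ w ∈ W, (Polynomial.C a : k[X]) • w ∈ W := by
    intro a w hw
    obtain ⟨u, hu, c, hc, rfl⟩ := AddSubgroup.mem_sup.mp hw
    rw [smul_add]
    refine W.add_mem (hUW _ (U.smul_mem _ hu)) (hBW _ ?_)
    rw [polynomial_smul_eq]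
    exact smul_mem_box hc (valued_C_le_one a)
  by_cases hall : ∀ j, b j ∈ W
  -- `W` contains all vectors with integral coordinates, hence `t` times the box, so that `W` is a
  -- `k[t]`-submodule; as it contains the basis and the box, it is everything
  · have htop : W = ⊤ := by
      have hint : ∀ v : V, (∀ i, Valued.v (b.repr v i) ≤ (1 : ℤᵐ⁰)) → v ∈ W := by
        intro v hv
        choose a ha using fun i => exists_constant_part (hv i)
        have h1 : v = ∑ i, (Polynomial.C (a i) : k[X]) • b i +
            ∑ i, (b.repr v i - algebraMap k[X] (KInfty k) (Polynomial.C (a i))) • b i := by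
          conv_lhs => rw [← b.sum_repr v]
          simp only [sub_smul, Finset.sum_sub_distrib, polynomial_smul_eq, add_sub_cancel]
        rw [h1]
        refine W.add_mem (W.sum_mem fun i _ => hC _ _ (hall i)) (hBW _ fun i => ?_)
        rw [b.repr_sum_self]
        exact ha i
      have hX : ∀ w ∈ W, (Polynomial.X : k[X]) • w ∈ W := by
        intro w hw
        obtain ⟨u, hu, c, hc, rfl⟩ := AddSubgroup.mem_sup.mp hw
        rw [smul_add]
        refine W.add_mem (hUW _ (U.smul_mem _ hu)) (hint _ fun i => ?_)
        rw [polynomial_smul_eq, algebraMap_X_eq_tInf, map_smul, Finsupp.smul_apply, smul_eq_mul,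
          map_mul, valued_tInf]
        by_cases h0 : Valued.v (b.repr c i) = (0 : ℤᵐ⁰)
        · simp [h0]
        have hci := hc i
        rw [← WithZero.exp_log h0, ← WithZero.exp_zero, WithZero.exp_lt_exp] at hci
        rw [← WithZero.exp_log h0, ← WithZero.exp_add, ← WithZero.exp_zero, WithZero.exp_le_exp]
        omega
      have hp : ∀ (p : k[X]), ∀ w ∈ W, p • w ∈ W := by
        intro p
        induction p using Polynomial.induction_on' with
        | add p q hp hq =>
          intro w hw
          rw [add_smul]
          exact W.add_mem (hp w hw) (hq w hw)
        | monomial m a =>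
          intro w hw
          rw [← Polynomial.C_mul_X_pow_eq_monomial, mul_smul]
          refine hC _ _ ?_
          induction m with
          | zero => simpa using hw
          | succ m hm =>
            rw [pow_succ', mul_smul]
            exact hX _ hm
      rw [eq_top_iff]
      intro v _
      choose p hpp using fun i => exists_polynomial_part (b.repr v i)
      have h1 : v = ∑ i, p i • b i +
          ∑ i, (b.repr v i - algebraMap k[X] (KInfty k) (p i)) • b i := by
        conv_lhs => rw [← b.sum_repr v]
        simp only [sub_smul, Finset.sum_sub_distrib, polynomial_smul_eq, add_sub_cancel]
      rw [h1]
      refine W.add_mem (W.sum_mem fun i _ => hp _ _ (hall i)) (hBW _ fun i => ?_)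
      rw [b.repr_sum_self]
      exact hpp i
    obtain ⟨l, hl, hdet⟩ := exists_basis_of_isCompl b U hd htop
    refine ⟨l, 0, hl, ?_, by simpa using hdet⟩
    rw [← hn, htop, AddSubgroup.index_top, pow_zero]
  · push Not at hall
    obtain ⟨j, hj⟩ := hall
    -- the line `k b_j` meets `W` in `0`, so that stretching along `b_j` adds `q` classes
    have hinj : ∀ a : k, (Polynomial.C a : k[X]) • b j ∈ W → a = 0 := by
      intro a ha
      by_contra h0
      apply hj
      have := hC a⁻¹ _ ha
      rwa [smul_smul, ← map_mul, inv_mul_cancel₀ h0, map_one, one_smul] at this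
    let f : k →+ V :=
      { toFun := fun a => (Polynomial.C a : k[X]) • b j
        map_zero' := by simp
        map_add' := fun a a' => by rw [map_add, add_smul] }
    set W' := U.toAddSubgroup ⊔ box (stretch b j) with hW'
    have hW'eq : W' = W ⊔ f.range := by
      have hbox : box (stretch b j) = box b ⊔ f.range := by
        ext v
        rw [mem_box_stretch, AddSubgroup.mem_sup]
        constructor
        · rintro ⟨a, ha⟩
          exact ⟨_, ha, f a, ⟨a, rfl⟩, sub_add_cancel _ _⟩
        · rintro ⟨c, hc, _, ⟨a, rfl⟩, rfl⟩
          exact ⟨a, by simpa [f] using hc⟩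
      rw [hW', hW, hbox, sup_assoc]
    have hrel : W.relIndex W' = Fintype.card k := by
      rw [hW'eq, AddSubgroup.relIndex_sup_left, ← AddSubgroup.index_comap]
      have : W.comap f = ⊥ := by
        rw [eq_bot_iff]
        intro a ha
        exact hinj a ha
      rw [this, AddSubgroup.index_bot, Nat.card_eq_fintype_card]
    have hmul : Fintype.card k * W'.index = n := by
      rw [← hrel, ← hn]
      exact AddSubgroup.relIndex_mul_index (hW'eq ▸ le_sup_left)
    have hq : 1 < Fintype.card k := Fintype.one_lt_card
    have h0 : W'.index ≠ 0 := by
      rintro h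
      rw [h, mul_zero] at hmul
      exact hn0 hmul.symm
    have hlt : W'.index < n := by
      rw [← hmul]
      exact lt_mul_of_one_lt_left (Nat.pos_of_ne_zero h0) hq
    obtain ⟨l, m, hl, hm, hdet⟩ := ih _ hlt (stretch b j) (fun v hv hvb => by
      obtain ⟨a, ha⟩ := mem_box_stretch.mp hvb
      have : a = 0 := hinj a (by
        rw [← sub_sub_self v ((Polynomial.C a : k[X]) • b j)]
        exact W.sub_mem (hUW _ hv) (hBW _ ha))
      subst this
      exact hd v hv (by simpa using ha)) rfl h0
    refine ⟨l, m + 1, hl, by rw [← hmul, hm, pow_succ'], ?_⟩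
    rw [valued_det_stretch b j, hdet, ← WithZero.exp_add]
    congr 1
    push_cast
    ring

/-- The basis `t⁻ᴺ b`. -/
def shrink (b : Module.Basis ι (KInfty k) V) (N : ℕ) : Module.Basis ι (KInfty k) V :=
  b.unitsSMul fun _ => Units.mk0 (tInf k) tInf_ne_zero ^ (-N : ℤ)

theorem repr_shrink (b : Module.Basis ι (KInfty k) V) (N : ℕ) (v : V) (i : ι) :
    (shrink b N).repr v i = tInf k ^ N * b.repr v i := by
  rw [shrink, Module.Basis.repr_unitsSMul, ← zpow_neg, neg_neg, zpow_natCast]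
  rfl

theorem mem_box_shrink {b : Module.Basis ι (KInfty k) V} {N : ℕ} {v : V} :
    v ∈ box (shrink b N) ↔ ∀ i, ‖b.repr v i‖ < (1 / 2) ^ N := by
  refine forall_congr' fun i => ?_
  rw [repr_shrink, ← norm_lt_one_iff, norm_mul, norm_pow, norm_tInf, one_div_pow,
    lt_div_iff₀' (by positivity)]

/-- A `k[t]`-submodule that contains a basis `b` has finite index modulo every box `t⁻ᴺ B_b`. -/
theorem index_sup_box_ne_zero (b : Module.Basis ι (KInfty k) V) (U : Submodule k[X] V)
    (hb : ∀ i, b i ∈ U) (N : ℕ) : (U.toAddSubgroup ⊔ box (shrink b N)).index ≠ 0 := by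
  set W := U.toAddSubgroup ⊔ box (shrink b N)
  have ht : tInf k ^ N ≠ 0 := pow_ne_zero _ tInf_ne_zero
  have : Finite (Polynomial.degreeLT k N) := Module.finite_of_finite k
  -- modulo `W`, every vector has coordinates of the form `t⁻ᴺ p` with `p` of degree less than `N`
  have hsurj : Function.Surjective fun c : ι → Polynomial.degreeLT k N =>
      (QuotientAddGroup.mk (∑ i, ((tInf k ^ N)⁻¹ * algebraMap k[X] (KInfty k) (c i)) • b i) :
        V ⧸ W) := by
    intro v
    obtain ⟨v, rfl⟩ := QuotientAddGroup.mk_surjective v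
    choose p hp using fun i => exists_polynomial_part (tInf k ^ N * b.repr v i)
    have hX : (Polynomial.X ^ N : k[X]).Monic := Polynomial.monic_X_pow N
    refine ⟨fun i => ⟨p i %ₘ Polynomial.X ^ N, ?_⟩, ?_⟩
    · rw [Polynomial.mem_degreeLT]
      simpa using Polynomial.degree_modByMonic_lt (p i) hX
    · rw [QuotientAddGroup.eq]
      refine AddSubgroup.mem_sup.mpr ⟨∑ i, (p i /ₘ Polynomial.X ^ N) • b i,
        U.sum_mem fun i _ => U.smul_mem _ (hb i),
        ∑ i, ((tInf k ^ N)⁻¹ * (tInf k ^ N * b.repr v i - algebraMap k[X] (KInfty k) (p i))) • b i,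
        fun i => ?_, ?_⟩
      · rw [repr_shrink, b.repr_sum_self, mul_inv_cancel_left₀ ht]
        exact hp i
      · conv_rhs => rw [← b.sum_repr v]
        rw [neg_add_eq_sub, ← Finset.sum_sub_distrib, ← Finset.sum_add_distrib]
        refine Finset.sum_congr rfl fun i _ => ?_
        rw [polynomial_smul_eq, ← add_smul, ← sub_smul]
        congr 1
        have h := congrArg (algebraMap k[X] (KInfty k))
          (Polynomial.modByMonic_add_div (p i) (Polynomial.X ^ N))
        rw [map_add, map_mul, map_pow, algebraMap_X_eq_tInf] at h
        rw [← h]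
        field_simp
        ring
  have : Finite (V ⧸ W) := Finite.of_surjective _ hsurj
  exact AddSubgroup.index_ne_zero_of_finite

end Lattice

/-! ### The exponential on integral algebras over `k((1/t))` -/

section ExpSum

variable {k : Type*} [Field k] [Fintype k] [DecidableEq (RatFunc k)]

/-- The absolute value of `e_i` is `|t| ^ (-i q ^ i)`. -/
theorem norm_expCoeff (i : ℕ) :
    ‖algebraMap (RatFunc k) (KInfty k) (expCoeff k i)‖ = (1 / 2) ^ (i * Fintype.card k ^ i) := by
  have hq : 1 < Fintype.card k := Fintype.one_lt_card
  induction i with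
  | zero => simp [expCoeff]
  | succ i ih =>
    have hden : ‖algebraMap (RatFunc k) (KInfty k)
        (RatFunc.X ^ Fintype.card k ^ (i + 1) - RatFunc.X)‖ = 2 ^ (Fintype.card k ^ (i + 1)) := by
      have h1 := FiniteField.X_pow_card_pow_sub_X_natDegree_eq k (p := Fintype.card k)
        (n := i + 1) (by omega) hq
      have h2 := valued_polynomial (FiniteField.X_pow_card_pow_sub_X_ne_zero k (p := Fintype.card k)
        (n := i + 1) (by omega) hq)
      rw [h1] at h2
      have h3 := norm_eq_zpow h2
      rw [IsScalarTower.algebraMap_apply k[X] (RatFunc k) (KInfty k)] at h3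
      rw [zpow_natCast] at h3
      simpa [RatFunc.algebraMap_X] using h3
    rw [expCoeff, map_div₀, norm_div, hden, map_pow, norm_pow, ih, ← pow_mul, div_eq_mul_inv,
      ← inv_pow, ← one_div, ← pow_add]
    congr 1
    ring

variable {M : Type*} [CommRing M] [TopologicalSpace M] [Algebra (KInfty k) M]

/-- The terms `e_i x ^ (q ^ i)` of the series `exp_E(x)` in a `k((1/t))`-algebra. -/
def expTerm (k : Type*) [Field k] [Fintype k] [DecidableEq (RatFunc k)]
    {M : Type*} [CommRing M] [Algebra (KInfty k) M] (x : M) (i : ℕ) : M :=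
  algebraMap (RatFunc k) (KInfty k) (expCoeff k i) • x ^ Fintype.card k ^ i

/-- The relation `exp_E(x) = y` in a topological `k((1/t))`-algebra. -/
def ExpSum (k : Type*) [Field k] [Fintype k] [DecidableEq (RatFunc k)]
    {M : Type*} [CommRing M] [TopologicalSpace M] [Algebra (KInfty k) M] (x y : M) : Prop :=
  HasSum (expTerm k x) y

theorem expTerm_zero (x : M) : expTerm k x 0 = x := by simp [expTerm, expCoeff]

theorem expTerm_add (x y : M) (i : ℕ) :
    expTerm k (x + y) i = expTerm k x i + expTerm k y i := by
  -- over `k`, the map `x ↦ x ^ q` is a homomorphism of algebras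
  let : Algebra k M := Algebra.compHom M ((algebraMap k[X] (KInfty k)).comp Polynomial.C)
  have h : (x + y) ^ Fintype.card k ^ i = x ^ Fintype.card k ^ i + y ^ Fintype.card k ^ i := by
    simpa [AlgHom.coe_pow, FiniteField.coe_frobeniusAlgHom, pow_iterate] using
      map_add (FiniteField.frobeniusAlgHom k M ^ i) x y
  rw [expTerm, h, smul_add]
  rfl

theorem expTerm_map {M' : Type*} [CommRing M'] [Algebra (KInfty k) M'] (f : M →ₐ[KInfty k] M')
    (x : M) (i : ℕ) : f (expTerm k x i) = expTerm k (f x) i := by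
  rw [expTerm, map_smul, map_pow]
  rfl

section

variable [IsTopologicalRing M]

theorem ExpSum.add {x y x' y' : M} (h : ExpSum k x y) (h' : ExpSum k x' y') :
    ExpSum k (x + x') (y + y') := by
  have h1 := HasSum.add h h'
  rwa [← funext (expTerm_add x x')] at h1

theorem ExpSum.neg {x y : M} (h : ExpSum k x y) : ExpSum k (-x) (-y) := by
  have hneg : ∀ i, expTerm k (-x) i = - expTerm k x i := fun i => by
    have h0 : expTerm k (0 : M) i = 0 := by simpa using expTerm_add (0 : M) 0 i
    rw [eq_neg_iff_add_eq_zero, ← expTerm_add (k := k), neg_add_cancel, h0]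
  unfold ExpSum
  rw [funext hneg]
  exact HasSum.neg h

theorem ExpSum.sub {x y x' y' : M} (h : ExpSum k x y) (h' : ExpSum k x' y') :
    ExpSum k (x - x') (y - y') := by
  rw [sub_eq_add_neg, sub_eq_add_neg]
  exact h.add h'.neg

theorem ExpSum.unique [T2Space M] {x y y' : M} (h : ExpSum k x y) (h' : ExpSum k x y') : y = y' :=
  HasSum.unique h h'

/-- The functional equation `exp_E(t x) = t exp_E(x) + exp_E(x) ^ q`. -/
theorem ExpSum.tInf_smul {x y : M} (h : ExpSum k x y) :
    ExpSum k (tInf k • x) (tInf k • y + y ^ Fintype.card k) := by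
  let i1 : Algebra (RatFunc k) M := Algebra.compHom M (algebraMap (RatFunc k) (KInfty k))
  let i2 : Algebra k[X] M := Algebra.compHom M (algebraMap k[X] (KInfty k))
  have i3 : IsScalarTower k[X] (RatFunc k) M := .of_algebraMap_eq fun _ => rfl
  have h1 : HasExp x (Points.of y : Points k M) := h
  have h2 := h1.X_smul
  rw [X_smul_of] at h2
  have hX : ∀ z : M, (Polynomial.X : k[X]) • z = tInf k • z := fun z => by
    change algebraMap k[X] (KInfty k) Polynomial.X • z = _
    rw [algebraMap_X_eq_tInf]
  rw [← Algebra.smul_def, hX, hX] at h2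
  exact h2

end

/-- Multiplication is bounded for the sup norm of the coordinates in a basis. -/
theorem exists_norm_mul_le {ι : Type*} [Fintype ι] (b : Module.Basis ι (KInfty k) M) :
    ∃ C : ℝ, 1 ≤ C ∧ ∀ x y : M, ‖b.equivFun (x * y)‖ ≤ C * ‖b.equivFun x‖ * ‖b.equivFun y‖ := by
  refine ⟨1 + ∑ i, ∑ j, ‖b.equivFun (b i * b j)‖, le_add_of_nonneg_right (by positivity),
    fun x y => ?_⟩
  have h : b.equivFun (x * y) =
      ∑ i, ∑ j, (b.equivFun x i * b.equivFun y j) • b.equivFun (b i * b j) := by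
    conv_lhs => rw [← b.sum_equivFun x, ← b.sum_equivFun y]
    simp only [Finset.sum_mul_sum, smul_mul_smul_comm, map_sum, map_smul]
  rw [h]
  refine (norm_sum_le _ _).trans ((Finset.sum_le_sum fun i _ => norm_sum_le _ _).trans ?_)
  have h2 : ∀ i j, ‖(b.equivFun x i * b.equivFun y j) • b.equivFun (b i * b j)‖ ≤
      ‖b.equivFun (b i * b j)‖ * (‖b.equivFun x‖ * ‖b.equivFun y‖) := fun i j => by
    rw [norm_smul, norm_mul, mul_comm]
    gcongr <;> exact norm_le_pi_norm _ _
  refine (Finset.sum_le_sum fun i _ => Finset.sum_le_sum fun j _ => h2 i j).trans ?_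
  simp only [← Finset.sum_mul]
  rw [mul_assoc]
  gcongr
  linarith

theorem norm_pow_le_of_norm_mul_le {ι : Type*} [Fintype ι] (b : Module.Basis ι (KInfty k) M)
    {C : ℝ} (hC : 1 ≤ C)
    (h : ∀ x y : M, ‖b.equivFun (x * y)‖ ≤ C * ‖b.equivFun x‖ * ‖b.equivFun y‖) (x : M) (n : ℕ) :
    ‖b.equivFun (x ^ (n + 1))‖ ≤ (C * ‖b.equivFun x‖) ^ n * ‖b.equivFun x‖ := by
  induction n with
  | zero => simp
  | succ n ih =>
    rw [pow_succ' x (n + 1)]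
    refine (h _ _).trans ?_
    rw [pow_succ' (C * _) n, mul_assoc (C * _)]
    gcongr

theorem norm_expTerm_le {ι : Type*} [Fintype ι] (b : Module.Basis ι (KInfty k) M)
    {C : ℝ} (hC : 1 ≤ C)
    (h : ∀ x y : M, ‖b.equivFun (x * y)‖ ≤ C * ‖b.equivFun x‖ * ‖b.equivFun y‖) (x : M) (i : ℕ) :
    ‖b.equivFun (expTerm k x i)‖ ≤ (1 / 2) ^ (i * Fintype.card k ^ i) *
      ((C * ‖b.equivFun x‖) ^ (Fintype.card k ^ i - 1) * ‖b.equivFun x‖) := by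
  rw [expTerm, map_smul, norm_smul, norm_expCoeff]
  gcongr
  have h1 : Fintype.card k ^ i = Fintype.card k ^ i - 1 + 1 :=
    (Nat.sub_add_cancel (Nat.one_le_pow _ _ Fintype.card_pos)).symm
  conv_lhs => rw [h1]
  exact norm_pow_le_of_norm_mul_le b hC h x _

/-- The exponential series converges on finite-dimensional algebras. -/
theorem exists_expSum_of_finite [IsTopologicalRing M] [ContinuousSMul (KInfty k) M] [T2Space M]
    [Module.Finite (KInfty k) M] (x : M) : ∃ y, ExpSum k x y := by
  let b := Module.finBasis (KInfty k) M
  obtain ⟨C, hC, hmul⟩ := exists_norm_mul_le b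
  let φ : M ≃L[KInfty k] (Fin _ → KInfty k) := b.equivFun.toContinuousLinearEquiv
  have hsum : Summable fun i => φ (expTerm k x i) := by
    set D := C * ‖b.equivFun x‖ + 1
    have hD : 1 ≤ D := le_add_of_nonneg_left (by positivity)
    obtain ⟨n, hn⟩ := pow_unbounded_of_one_lt (2 * D) one_lt_two
    refine Summable.of_norm_bounded_eventually_nat (g := fun i => (1 / 2 : ℝ) ^ i)
      summable_geometric_two ?_
    filter_upwards [Filter.eventually_ge_atTop n] with i hi
    have hq : 1 < Fintype.card k := Fintype.one_lt_card
    have h1 : 1 ≤ Fintype.card k ^ i := Nat.one_le_pow _ _ (by omega)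
    have h2 : ‖b.equivFun x‖ ≤ D := by
      refine le_trans ?_ (le_add_of_nonneg_right zero_le_one)
      exact le_mul_of_one_le_left (norm_nonneg _) hC
    calc ‖φ (expTerm k x i)‖ ≤ (1 / 2) ^ (i * Fintype.card k ^ i) *
          ((C * ‖b.equivFun x‖) ^ (Fintype.card k ^ i - 1) * ‖b.equivFun x‖) :=
        norm_expTerm_le b hC hmul x i
      _ ≤ (1 / 2) ^ (i * Fintype.card k ^ i) * (D ^ (Fintype.card k ^ i - 1) * D) := by
        gcongr
        exact le_add_of_nonneg_right zero_le_one
      _ = ((1 / 2) ^ i * D) ^ (Fintype.card k ^ i) := by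
        rw [← pow_succ, Nat.sub_add_cancel h1, pow_mul, ← mul_pow]
      _ ≤ (1 / 2) ^ (Fintype.card k ^ i) := by
        gcongr
        rw [one_div_pow, div_mul_eq_mul_div, one_mul,
          div_le_div_iff₀ (by positivity) (by positivity), one_mul, mul_comm]
        exact hn.le.trans (pow_le_pow_right₀ one_le_two hi)
      _ ≤ (1 / 2) ^ i := pow_le_pow_of_le_one (by norm_num) (by norm_num)
        (Nat.lt_pow_self hq).le
  obtain ⟨z, hz⟩ := hsum
  refine ⟨φ.symm z, ?_⟩
  have h := hz.map φ.symm φ.symm.continuous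
  have hfun : (φ.symm ∘ fun i => φ (expTerm k x i)) = expTerm k x :=
    funext fun i => φ.symm_apply_apply _
  rwa [hfun] at h

section Integral

variable [IsTopologicalRing M] [ContinuousSMul (KInfty k) M] [T2Space M]

theorem isTopologicalRing_subalgebra (S : Subalgebra (KInfty k) M) : IsTopologicalRing S :=
  inferInstanceAs (IsTopologicalRing S.toSubring)

/-- The exponential of an integral element exists, and it lies in the (complete) finite-dimensional
algebra generated by this element. -/
theorem exists_expSum_mem_adjoin {x : M} (hx : IsIntegral (KInfty k) x) :
    ∃ y : Algebra.adjoin (KInfty k) {x},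
      ExpSum k (⟨x, Algebra.self_mem_adjoin_singleton _ x⟩ : Algebra.adjoin (KInfty k) {x}) y ∧
      ExpSum k x (y : M) := by
  have : Module.Finite (KInfty k) (Algebra.adjoin (KInfty k) {x}) :=
    Module.Finite.iff_fg.mpr hx.fg_adjoin_singleton
  have := isTopologicalRing_subalgebra (Algebra.adjoin (KInfty k) {x})
  obtain ⟨y, hy⟩ := exists_expSum_of_finite (k := k)
    (⟨x, Algebra.self_mem_adjoin_singleton _ x⟩ : Algebra.adjoin (KInfty k) {x})
  refine ⟨y, hy, ?_⟩
  exact HasSum.map hy (Algebra.adjoin (KInfty k) {x}).val continuous_subtype_val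

/-- The exponential of integral elements is natural for all homomorphisms of algebras, continuous
or not, because it is computed inside finite-dimensional algebras. -/
theorem ExpSum.map {M' : Type*} [CommRing M'] [TopologicalSpace M'] [Algebra (KInfty k) M']
    [IsTopologicalRing M'] [ContinuousSMul (KInfty k) M'] (f : M →ₐ[KInfty k] M') {x y : M}
    (hx : IsIntegral (KInfty k) x) (h : ExpSum k x y) : ExpSum k (f x) (f y) := by
  obtain ⟨z, hz, hz'⟩ := exists_expSum_mem_adjoin hx
  have : Module.Finite (KInfty k) (Algebra.adjoin (KInfty k) {x}) :=
    Module.Finite.iff_fg.mpr hx.fg_adjoin_singleton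
  have := isTopologicalRing_subalgebra (Algebra.adjoin (KInfty k) {x})
  rw [h.unique hz']
  let g := f.comp (Algebra.adjoin (KInfty k) {x}).val
  have hg : Continuous g := g.toLinearMap.continuous_of_finiteDimensional
  have h1 := HasSum.map hz g hg
  have hfun : (g ∘ expTerm k (⟨x, Algebra.self_mem_adjoin_singleton _ x⟩ :
      Algebra.adjoin (KInfty k) {x})) = expTerm k (f x) :=
    funext fun i => expTerm_map g _ i
  rwa [hfun] at h1

end Integral

theorem norm_sub_le_max_norm {E : Type*} [SeminormedAddCommGroup E] [IsUltrametricDist E]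
    (x y : E) : ‖x - y‖ ≤ max ‖x‖ ‖y‖ := by
  simpa [sub_eq_add_neg] using IsUltrametricDist.norm_add_le_max x (-y)

section LocalIsometry

variable [IsTopologicalRing M] {E : Type*} [NormedAddCommGroup E] [NormedSpace (KInfty k) E]
  [IsUltrametricDist E] (φ : M ≃L[KInfty k] E) {ρ : ℝ}

/-- On a ball on which the terms of positive index of the series shrink norms by a factor `2`,
so does `exp_E - id`. -/
theorem ExpSum.norm_sub_le
    (hρ : ∀ x, ‖φ x‖ ≤ ρ → ∀ i, i ≠ 0 → ‖φ (expTerm k x i)‖ ≤ 1 / 2 * ‖φ x‖)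
    {x y : M} (hx : ‖φ x‖ ≤ ρ) (h : ExpSum k x y) : ‖φ (y - x)‖ ≤ 1 / 2 * ‖φ x‖ := by
  have h1 : HasSum (fun i => φ (expTerm k x (i + 1))) (φ (y - x)) := by
    have h2 := (hasSum_nat_add_iff' 1).mpr h
    rw [Finset.sum_range_one, expTerm_zero] at h2
    exact h2.map φ φ.continuous
  refine le_of_tendsto (Filter.Tendsto.norm h1) (Filter.Eventually.of_forall fun s => ?_)
  exact IsUltrametricDist.norm_sum_le_of_forall_le_of_nonneg (by positivity)
    fun i _ => hρ x hx _ (Nat.succ_ne_zero i)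

/-- On such a ball every element is an exponential, by the contraction principle applied to
`x ↦ y - (exp_E(x) - x)`. -/
theorem exists_expSum_of_norm_le [CompleteSpace E] (hex : ∀ x : M, ∃ y, ExpSum k x y)
    (hρ : ∀ x, ‖φ x‖ ≤ ρ → ∀ i, i ≠ 0 → ‖φ (expTerm k x i)‖ ≤ 1 / 2 * ‖φ x‖)
    {y : M} (hy : ‖φ y‖ ≤ ρ) : ∃ x, ‖φ x‖ ≤ ‖φ y‖ ∧ ExpSum k x y := by
  have : T2Space M := φ.toHomeomorph.symm.t2Space
  choose e he using hex
  let f : E → E := fun z => φ (y - (e (φ.symm z) - φ.symm z))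
  have hmaps : Set.MapsTo f (Metric.closedBall 0 ‖φ y‖) (Metric.closedBall 0 ‖φ y‖) := by
    intro z hz
    rw [mem_closedBall_zero_iff] at hz ⊢
    have h1 := (he (φ.symm z)).norm_sub_le φ hρ (by simpa using hz.trans hy)
    rw [φ.apply_symm_apply] at h1
    simp only [f, map_sub φ y]
    refine (norm_sub_le_max_norm _ _).trans (max_le le_rfl ?_)
    linarith [norm_nonneg z]
  have hcontr : ContractingWith (1 / 2) (hmaps.restrict f _ _) := by
    refine ⟨by simpa using NNReal.half_lt_self one_ne_zero,
      LipschitzWith.of_dist_le_mul fun z w => ?_⟩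
    have hzw : ‖φ (φ.symm z.1 - φ.symm w.1)‖ ≤ ρ := by
      rw [map_sub, φ.apply_symm_apply, φ.apply_symm_apply]
      refine (norm_sub_le_max_norm _ _).trans (max_le ?_ ?_)
      · exact (mem_closedBall_zero_iff.mp z.2).trans hy
      · exact (mem_closedBall_zero_iff.mp w.2).trans hy
    have h1 := ((he (φ.symm z)).sub (he (φ.symm w))).norm_sub_le φ hρ hzw
    rw [Subtype.dist_eq, Subtype.dist_eq, dist_eq_norm, dist_eq_norm]
    change ‖f z - f w‖ ≤ _
    have h2 : f z - f w = - φ (e (φ.symm z) - e (φ.symm w) - (φ.symm z - φ.symm w)) := by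
      simp only [f]
      rw [← map_sub φ, ← map_neg φ]
      congr 1
      abel
    rw [h2, norm_neg]
    simpa using h1
  obtain ⟨z, hz, hfix, -⟩ := ContractingWith.exists_fixedPoint'
    Metric.isClosed_closedBall.isComplete hmaps hcontr
    (Metric.mem_closedBall_self (norm_nonneg _)) (edist_ne_top _ _)
  refine ⟨φ.symm z, by simpa using hz, ?_⟩
  have h1 : e (φ.symm z) = y := by
    have h2 : f z = z := hfix
    have h3 := congrArg φ.symm h2
    simp only [f, φ.symm_apply_apply] at h3
    rw [sub_eq_iff_eq_add, ← sub_eq_iff_eq_add'] at h3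
    exact (sub_left_inj.mp h3).symm
  exact h1 ▸ he _

end LocalIsometry

/-- The estimate that makes the exponential an isometry on the ball `|x| ≤ |t|`. -/
theorem half_pow_mul_pow_le {a : ℝ} (h0 : 0 ≤ a) (h2 : a ≤ 2) {q i : ℕ} (hq : 1 < q)
    (hi : i ≠ 0) : (1 / 2 : ℝ) ^ (i * q ^ i) * a ^ (q ^ i - 1) ≤ 1 / 2 := by
  have h1 : 1 ≤ q ^ i := Nat.one_le_pow _ _ (by omega)
  calc (1 / 2 : ℝ) ^ (i * q ^ i) * a ^ (q ^ i - 1) ≤ (1 / 2) ^ (q ^ i) * 2 ^ (q ^ i - 1) := by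
        refine mul_le_mul ?_ (pow_le_pow_left₀ h0 h2 _) (by positivity) (by positivity)
        exact pow_le_pow_of_le_one (by norm_num) (by norm_num)
          (Nat.le_mul_of_pos_left _ (Nat.pos_of_ne_zero hi))
    _ = 1 / 2 := by
        conv_lhs => rw [← Nat.sub_add_cancel h1, pow_succ]
        rw [Nat.add_sub_cancel, mul_right_comm, ← mul_pow]
        norm_num

/-- On a finite-dimensional algebra, the terms of positive index of the series shrink norms on all
sufficiently small balls. -/
theorem exists_radius {ι : Type*} [Fintype ι] (b : Module.Basis ι (KInfty k) M) :
    ∃ ρ : ℝ, 0 < ρ ∧ ∀ x, ‖b.equivFun x‖ ≤ ρ → ∀ i, i ≠ 0 →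
      ‖b.equivFun (expTerm k x i)‖ ≤ 1 / 2 * ‖b.equivFun x‖ := by
  obtain ⟨C, hC, hmul⟩ := exists_norm_mul_le b
  refine ⟨2 / C, by positivity, fun x hx i hi => (norm_expTerm_le b hC hmul x i).trans ?_⟩
  rw [← mul_assoc]
  gcongr
  refine half_pow_mul_pow_le (by positivity) ?_ Fintype.one_lt_card hi
  rwa [le_div_iff₀' (by positivity)] at hx

end ExpSum

/-! ### Surjectivity of the exponential over separably closed fields -/

section Surjective

variable {k : Type*} [Field k] [Fintype k] [DecidableEq (RatFunc k)]

theorem cast_card_eq_zero_of_algebra (M : Type*) [CommRing M] [Algebra (KInfty k) M] :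
    (Fintype.card k : M) = 0 := by
  rw [← map_natCast ((algebraMap (KInfty k) M).comp
      ((algebraMap k[X] (KInfty k)).comp Polynomial.C)),
    FiniteField.cast_card_eq_zero, map_zero]

/-- The `t`-division equation `t b + b ^ q = y` is separable, hence solvable over a separably closed
field. -/
theorem exists_tInf_division {N : Type*} [Field N] [Algebra (KInfty k) N] [IsSepClosed N] (y : N) :
    ∃ b : N, tInf k • b + b ^ Fintype.card k = y := by
  have hq : 1 < Fintype.card k := Fintype.one_lt_card
  set c := algebraMap (KInfty k) N (tInf k)
  have hc : c ≠ 0 := by simpa [c] using tInf_ne_zero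
  let P : Polynomial N := Polynomial.X ^ Fintype.card k +
    (Polynomial.C c * Polynomial.X - Polynomial.C y)
  have hder : P.derivative = Polynomial.C c := by
    simp [P, Polynomial.derivative_X_pow, cast_card_eq_zero_of_algebra (k := k) N]
  have hsep : P.Separable := by
    rw [Polynomial.Separable, hder]
    obtain ⟨u, hu⟩ := (Polynomial.isUnit_C.mpr hc.isUnit).exists_left_inv
    exact ⟨0, u, by rw [zero_mul, zero_add, hu]⟩
  have hdeg : P.degree ≠ 0 := by
    intro h
    rw [Polynomial.eq_C_of_degree_eq_zero h, Polynomial.derivative_C] at hder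
    exact hc (Polynomial.C_eq_zero.mp hder.symm)
  obtain ⟨b, hb⟩ := IsSepClosed.exists_root P hdeg hsep
  refine ⟨b, ?_⟩
  have h : b ^ Fintype.card k + (c * b - y) = 0 := by simpa [P] using hb
  rw [Algebra.smul_def]
  linear_combination h

/-- An element of absolute value at most `|t|` is the exponential of an element of the complete
subfield that it generates. -/
theorem exists_expSum_of_norm_le_two {N : Type*} [NormedField N] [NormedAlgebra (KInfty k) N]
    [IsUltrametricDist N] [Algebra.IsIntegral (KInfty k) N] {y : N} (hy : ‖y‖ ≤ 2) :
    ∃ x, ExpSum k x y := by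
  let S := Algebra.adjoin (KInfty k) {y}
  have : Module.Finite (KInfty k) S :=
    Module.Finite.iff_fg.mpr (Algebra.IsIntegral.isIntegral y).fg_adjoin_singleton
  have := isTopologicalRing_subalgebra S
  have : CompleteSpace S := FiniteDimensional.complete (KInfty k) S
  have : IsUltrametricDist S := inferInstanceAs (IsUltrametricDist (S : Set N))
  let y' : S := ⟨y, Algebra.self_mem_adjoin_singleton _ y⟩
  obtain ⟨x, -, hx⟩ := exists_expSum_of_norm_le (M := S) (k := k) (ρ := 2) (y := y')
    (ContinuousLinearEquiv.refl (KInfty k) S) exists_expSum_of_finite (fun x hx i hi => by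
      have hx2 : ‖(x : N)‖ ≤ 2 := hx
      change ‖(expTerm k x i : N)‖ ≤ 1 / 2 * ‖(x : N)‖
      have h1 : (expTerm k x i : N) = expTerm k (x : N) i := expTerm_map S.val x i
      have h2 : Fintype.card k ^ i = Fintype.card k ^ i - 1 + 1 :=
        (Nat.sub_add_cancel (Nat.one_le_pow _ _ Fintype.card_pos)).symm
      rw [h1, expTerm, norm_smul, norm_expCoeff, norm_pow]
      nth_rewrite 2 [h2]
      rw [pow_succ, ← mul_assoc]
      gcongr
      exact half_pow_mul_pow_le (norm_nonneg _) hx2 Fintype.one_lt_card hi) hy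
  refine ⟨x, ?_⟩
  have h := HasSum.map hx S.val continuous_subtype_val
  have hfun : (S.val ∘ expTerm k x) = expTerm k (x : N) := funext fun i => expTerm_map S.val x i
  rwa [hfun] at h

/-- The exponential is surjective over a separably closed field. Large elements are reached from
smaller ones by `t`-division, which takes a `q`-th root of large absolute values. -/
theorem exists_expSum_of_isSepClosed {N : Type*} [NormedField N] [NormedAlgebra (KInfty k) N]
    [IsUltrametricDist N] [Algebra.IsIntegral (KInfty k) N] [IsSepClosed N] (y : N) :
    ∃ x, ExpSum k x y := by
  have hq : 1 < Fintype.card k := Fintype.one_lt_card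
  have key : ∀ (n : ℕ) (y : N), ‖y‖ ≤ 2 ^ (Fintype.card k ^ n) → ∃ x, ExpSum k x y := by
    intro n
    induction n with
    | zero => exact fun y hy => exists_expSum_of_norm_le_two (by simpa using hy)
    | succ n ih =>
      intro y hy
      obtain ⟨b, rfl⟩ := exists_tInf_division (k := k) y
      obtain ⟨x, hx⟩ := ih b (by
        by_contra! hb
        have h1 : (2 : ℝ) ≤ 2 ^ Fintype.card k ^ n := by
          simpa using pow_le_pow_right₀ (one_le_two (α := ℝ)) (Nat.one_le_pow n _ (by omega))
        have h2 : 2 < ‖b‖ := h1.trans_lt hb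
        have h3 : ‖tInf k • b‖ < ‖b ^ Fintype.card k‖ := by
          rw [norm_smul, norm_tInf, norm_pow]
          calc 2 * ‖b‖ < ‖b‖ * ‖b‖ := by gcongr
            _ = ‖b‖ ^ 2 := (sq _).symm
            _ ≤ ‖b‖ ^ Fintype.card k := pow_le_pow_right₀ (by linarith) hq
        rw [IsUltrametricDist.norm_add_eq_max_of_norm_ne_norm h3.ne, max_eq_right h3.le, norm_pow,
          pow_succ, pow_mul] at hy
        exact absurd hy (not_le.mpr (pow_lt_pow_left₀ hb (by positivity) (by omega))))
      exact ⟨_, hx.tInf_smul⟩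
  obtain ⟨n, hn⟩ := pow_unbounded_of_one_lt ‖y‖ one_lt_two
  exact key n y (hn.le.trans (pow_le_pow_right₀ one_le_two (Nat.lt_pow_self hq).le))

/-- An algebraic extension of a separably closed field, separable or not, is separably closed. -/
theorem isSepClosed_of_isAlgebraic (S N : Type*) [Field S] [Field N] [Algebra S N] [IsSepClosed S]
    [Algebra.IsAlgebraic S N] : IsSepClosed N := by
  have : Algebra.IsAlgebraic S (AlgebraicClosure N) := Algebra.IsAlgebraic.trans S N _
  rw [isSepClosed_iff_isPurelyInseparable_algebraicClosure N (AlgebraicClosure N)]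
  exact IsPurelyInseparable.tower_top S N (AlgebraicClosure N)

variable {M : Type*} [CommRing M] [TopologicalSpace M] [Algebra (KInfty k) M]
  [IsTopologicalRing M] [ContinuousSMul (KInfty k) M] [T2Space M] [Algebra.IsIntegral (KInfty k) M]

/-- In every separably closed residue field `N` there is a value `z` such that all elements that map
to `z` have an exponential congruent to `y`. -/
theorem exists_expSum_congr {N : Type*} [Field N] [Algebra (KInfty k) N] [IsSepClosed N]
    [Algebra.IsAlgebraic (KInfty k) N] (f : M →ₐ[KInfty k] N) (y : M) :
    ∃ z : N, ∀ x y', ExpSum k x y' → f x = z → f y' = f y := by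
  let : NormedField N := spectralNorm.normedField (KInfty k) N
  let : NormedAlgebra (KInfty k) N := spectralNorm.normedAlgebra (KInfty k) N
  have : IsUltrametricDist N :=
    IsUltrametricDist.isUltrametricDist_of_isNonarchimedean_norm
      (isNonarchimedean_spectralNorm (K := KInfty k) (L := N))
  obtain ⟨z, hz⟩ := exists_expSum_of_isSepClosed (k := k) (f y)
  refine ⟨z, fun x y' h hx => ?_⟩
  have h1 := h.map f (Algebra.IsIntegral.isIntegral x)
  rw [hx] at h1
  exact h1.unique hz

/-- On a nilpotent element the series is finite, and it differs from the identity by terms of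
higher order. -/
theorem ExpSum.sub_mem_pow_succ {I : Ideal M} {s : ℕ} (hs : I ^ s = ⊥) {j : ℕ} (hj : j ≠ 0)
    {x y : M} (hx : x ∈ I ^ j) (h : ExpSum k x y) : x - y ∈ I ^ (j + 1) := by
  have hq : 1 < Fintype.card k := Fintype.one_lt_card
  have hmem : ∀ i, expTerm k x (i + 1) ∈ I ^ ((i + 1) * (j + 1)) := fun i => by
    rw [expTerm, Algebra.smul_def]
    refine Ideal.mul_mem_left _ _ (Ideal.pow_le_pow_right ?_
      (pow_mul I j _ ▸ Ideal.pow_mem_pow hx _))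
    have h1 : i + 1 ≤ 2 ^ i := Nat.lt_two_pow_self
    have h2 : 2 ^ (i + 1) ≤ Fintype.card k ^ (i + 1) := Nat.pow_le_pow_left hq _
    calc (i + 1) * (j + 1) ≤ 2 ^ i * (j * 2) := Nat.mul_le_mul h1 (by omega)
      _ = j * 2 ^ (i + 1) := by ring
      _ ≤ j * Fintype.card k ^ (i + 1) := Nat.mul_le_mul_left _ h2
  have h0 : ∀ i ∉ Finset.range (s + 1), expTerm k x i = 0 := fun i hi => by
    rw [Finset.mem_range, not_lt] at hi
    obtain ⟨i, rfl⟩ := Nat.exists_eq_add_of_le' (le_trans (Nat.le_add_left 1 s) hi)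
    have h1 := Ideal.pow_le_pow_right (I := I) (m := s)
      (le_trans (by omega) (Nat.le_mul_of_pos_right (i + 1) (Nat.succ_pos j))) (hmem i)
    rwa [hs, Ideal.mem_bot] at h1
  have hy := HasSum.unique h (hasSum_sum_of_ne_finset_zero h0)
  rw [hy, Finset.sum_range_succ', expTerm_zero, sub_add_cancel_right]
  refine neg_mem (sum_mem fun i _ => ?_)
  exact Ideal.pow_le_pow_right (Nat.le_mul_of_pos_left _ (Nat.succ_pos i)) (hmem i)

/-- The exponential is surjective on a finite algebra over a separably closed field: it is so
modulo every maximal ideal, and then modulo every power of the nilradical. -/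
theorem exists_expSum_of_finite_isSepClosed (S : Type*) [Field S] [Algebra (KInfty k) S]
    [IsSepClosed S] [Algebra S M] [IsScalarTower (KInfty k) S M] [Module.Finite S M] (y : M) :
    ∃ x, ExpSum k x y := by
  have : IsArtinianRing M := IsArtinianRing.of_finite S M
  have hres : ∀ (m : MaximalSpectrum M), ∃ z : M ⧸ m.asIdeal, ∀ x y', ExpSum k x y' →
      Ideal.Quotient.mk m.asIdeal x = z → y - y' ∈ m.asIdeal := by
    intro m
    let : Field (M ⧸ m.asIdeal) := Ideal.Quotient.field m.asIdeal
    have : Algebra.IsAlgebraic S (M ⧸ m.asIdeal) := inferInstance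
    have := isSepClosed_of_isAlgebraic S (M ⧸ m.asIdeal)
    have : Algebra.IsIntegral (KInfty k) (M ⧸ m.asIdeal) := inferInstance
    obtain ⟨z, hz⟩ := exists_expSum_congr (Ideal.Quotient.mkₐ (KInfty k) m.asIdeal) y
    refine ⟨z, fun x y' h hx => ?_⟩
    rw [← Ideal.Quotient.eq]
    exact (hz x y' h hx).symm
  choose z hz using hres
  -- solutions modulo all maximal ideals are glued by the Chinese remainder theorem
  obtain ⟨x, hx⟩ := Ideal.pi_quotient_surjective (I := fun m : MaximalSpectrum M => m.asIdeal)
    (fun m m' h => Ideal.isCoprime_of_isMaximal (fun h' => h (MaximalSpectrum.ext h'))) z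
  obtain ⟨y', -, hy'⟩ := exists_expSum_mem_adjoin (k := k)
    (Algebra.IsIntegral.isIntegral (R := KInfty k) x)
  have hnil : y - y' ∈ nilradical M := by
    rw [mem_nilradical, nilpotent_iff_mem_prime]
    exact fun P hP => hz ⟨P, IsArtinianRing.isMaximal_of_isPrime P⟩ x y' hy' (hx _)
  obtain ⟨s, hs⟩ := IsArtinianRing.isNilpotent_nilradical (R := M)
  -- descending induction on the power of the nilradical that contains `w`
  have key : ∀ n j, j ≠ 0 → s ≤ j + n → ∀ w ∈ nilradical M ^ j, ∃ x, ExpSum k x w := by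
    intro n
    induction n with
    | zero =>
      intro j _ hj w hw
      have hw0 : w = 0 := by simpa [hs] using Ideal.pow_le_pow_right hj hw
      subst hw0
      refine ⟨0, ?_⟩
      have h := hy'.sub hy'
      rwa [sub_self, sub_self] at h
    | succ n ih =>
      intro j hj0 hj w hw
      obtain ⟨w', -, hw'⟩ := exists_expSum_mem_adjoin (k := k)
        (Algebra.IsIntegral.isIntegral (R := KInfty k) w)
      obtain ⟨v, hv⟩ := ih (j + 1) (Nat.succ_ne_zero j) (by omega) _
        (hw'.sub_mem_pow_succ hs hj0 hw)
      exact ⟨w + v, by simpa using hw'.add hv⟩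
  obtain ⟨v, hv⟩ := key s 1 one_ne_zero (by omega) _ (by simpa using hnil)
  exact ⟨x + v, by simpa using hy'.add hv⟩

end Surjective

/-! ### Galois descent for `K_∞^sep` -/

section Descent

variable {k : Type*} [Field k] [DecidableEq (RatFunc k)]

instance : IsGalois (KInfty k) (KSep k) := IsSepClosure.isGalois

instance : IsSepClosed (KSep k) := IsSepClosure.sep_closed (KInfty k)

/-- The additive form of Hilbert's Theorem 90, for continuous cocycles with values in the discrete
module `k((1/t))^sep`. -/
theorem exists_eq_sub_of_cocycle {c : Gal k → KSep k} (hc : IsLocallyConstant c)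
    (h : ∀ σ τ, c (σ * τ) = c σ + σ (c τ)) : ∃ x, ∀ σ, c σ = σ x - x := by
  have h1 : c 1 = 0 := by simpa using h 1 1
  have hopen : {σ | c σ = 0} ∈ nhds (1 : Gal k) := (hc.isOpen_fiber 0).mem_nhds h1
  obtain ⟨L, hLfin, hLn, hL⟩ :=
    (krullTopology_mem_nhds_one_iff_of_normal (KInfty k) (KSep k) _).mp hopen
  have : IsGalois (KInfty k) L := ⟨⟩
  -- `c` vanishes on `Gal(F^sep/L)`, so it factors through the finite group `Gal(L/F)`; an element
  -- `θ` of trace `1` then provides the weights of an average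
  let lift : (L ≃ₐ[KInfty k] L) → Gal k := fun g => g.liftNormal (KSep k)
  let res : Gal k →* (L ≃ₐ[KInfty k] L) := AlgEquiv.restrictNormalHom L
  have hlift : ∀ g (z : L), lift g z = (g z : KSep k) := fun g z => g.liftNormal_commutes (KSep k) z
  have hres : ∀ (σ : Gal k) (z : L), ((res σ) z : KSep k) = σ z :=
    fun σ z => AlgEquiv.restrictNormal_commutes σ L z
  have hd : ∀ σ, c (lift (res σ)) = c σ := by
    intro σ
    have h2 : c ((lift (res σ))⁻¹ * σ) = 0 := by
      refine hL ?_
      rw [SetLike.mem_coe, IntermediateField.mem_fixingSubgroup_iff]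
      intro z hz
      change (lift (res σ)).symm (σ z) = z
      rw [AlgEquiv.symm_apply_eq, hlift _ ⟨z, hz⟩, hres]
    conv_rhs => rw [← mul_inv_cancel_left (lift (res σ)) σ, h, h2, map_zero, add_zero]
  obtain ⟨θ, hθ⟩ := Algebra.trace_surjective (KInfty k) L 1
  have hsum : ∑ g : L ≃ₐ[KInfty k] L, (g θ : KSep k) = 1 := by
    have h3 := congrArg (algebraMap L (KSep k)) (trace_eq_sum_automorphisms (K := KInfty k) θ)
    rw [hθ, map_one, map_one, map_sum] at h3
    exact h3.symm
  refine ⟨-∑ g, c (lift g) * (g θ : KSep k), fun σ => ?_⟩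
  have key : ∀ g, σ (c (lift g)) = c (lift (res σ * g)) - c σ := fun g => by
    have h4 : c (σ * lift g) = c (lift (res σ * g)) := by
      rw [← hd (σ * lift g), map_mul]
      congr 3
      ext z
      rw [hres, hlift]
    rw [← h4, h, add_sub_cancel_left]
  have h5 : σ (∑ g, c (lift g) * (g θ : KSep k)) = ∑ g, c (lift g) * (g θ : KSep k) - c σ := by
    rw [map_sum]
    simp only [map_mul, key, sub_mul, Finset.sum_sub_distrib, ← hres]
    rw [← Fintype.sum_equiv (Equiv.mulLeft (res σ)) (fun g => c (lift (res σ * g)) *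
      ((res σ) (g θ) : KSep k)) (fun g => c (lift g) * (g θ : KSep k)) (fun g => rfl)]
    congr 1
    rw [← Finset.mul_sum, Fintype.sum_equiv (Equiv.mulLeft (res σ)) (fun g =>
      ((res σ) (g θ) : KSep k)) (fun g => (g θ : KSep k)) (fun g => rfl), hsum, mul_one]
  rw [map_neg, h5]
  ring

theorem continuous_algebraMap_KSep : Continuous (algebraMap (KInfty k) (KSep k)) :=
  (AddMonoidHomClass.isometry_of_norm (algebraMap (KInfty k) (KSep k))
    fun f => spectralNorm_extends (K := KInfty k) (L := KSep k) f).continuous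

variable (K : Type*) [Field K] [Algebra (RatFunc k) K]

instance : Algebra (KInfty k) (KInfSep k K) :=
  ((algebraMap (KSep k) (KInfSep k K)).comp (algebraMap (KInfty k) (KSep k))).toAlgebra

instance : IsScalarTower (KInfty k) (KSep k) (KInfSep k K) := .of_algebraMap_eq fun _ => rfl

instance : IsScalarTower (RatFunc k) (KInfty k) (KInfSep k K) := .of_algebraMap_eq fun r => by
  rw [IsScalarTower.algebraMap_apply (RatFunc k) (KSep k) (KInfSep k K),
    IsScalarTower.algebraMap_apply (RatFunc k) (KInfty k) (KSep k)]
  rfl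

/-- The action of an element of `G` on `K_∞^sep`, as a homomorphism of `k((1/t))`-algebras. -/
def galActInfty (σ : Gal k) : KInfSep k K →ₐ[KInfty k] KInfSep k K :=
  { galAct K σ with
    commutes' := fun f => by
      change (Algebra.TensorProduct.map _ _ : KSep k ⊗[RatFunc k] K →ₐ[RatFunc k] _)
        (algebraMap (KInfty k) (KSep k) f ⊗ₜ[RatFunc k] 1) =
          algebraMap (KInfty k) (KSep k) f ⊗ₜ[RatFunc k] 1
      simp }

/-- The inclusion `K_∞ → K_∞^sep`, as a homomorphism of `k((1/t))`-algebras. -/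
def toSepInfty : KInf k K →ₐ[KInfty k] KInfSep k K :=
  { toSep k K with
    commutes' := fun f => by
      change (Algebra.TensorProduct.map _ _ : KInfty k ⊗[RatFunc k] K →ₐ[RatFunc k] _)
        (f ⊗ₜ[RatFunc k] 1) = algebraMap (KInfty k) (KSep k) f ⊗ₜ[RatFunc k] 1
      simp }

variable [FiniteDimensional (RatFunc k) K]

/-- The basis of `K_∞` over `k((1/t))` given by a basis of `K` over `k(t)`. -/
def basisInf {ι : Type*} (b : Module.Basis ι (RatFunc k) K) :
    Module.Basis ι (KInfty k) (KInf k K) :=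
  (Algebra.TensorProduct.basis (KInfty k) b :
    Module.Basis ι (KInfty k) (KInfty k ⊗[RatFunc k] K))

/-- The basis of `K_∞^sep` over `k((1/t))^sep` given by a basis of `K` over `k(t)`. -/
def basisSep {ι : Type*} (b : Module.Basis ι (RatFunc k) K) :
    Module.Basis ι (KSep k) (KInfSep k K) :=
  (Algebra.TensorProduct.basis (KSep k) b : Module.Basis ι (KSep k) (KSep k ⊗[RatFunc k] K))

variable {K} {ι : Type*} (b : Module.Basis ι (RatFunc k) K)

theorem basisInf_apply (i : ι) : basisInf K b i = ofField k K (b i) :=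
  Algebra.TensorProduct.basis_apply _ _

theorem basisSep_repr_galAct (σ : Gal k) (x : KInfSep k K) (i : ι) :
    (basisSep K b).repr (galAct K σ x) i = σ ((basisSep K b).repr x i) := by
  change (Algebra.TensorProduct.basis (KSep k) b).repr (Algebra.TensorProduct.map _ _ x) i =
    σ ((Algebra.TensorProduct.basis (KSep k) b).repr x i)
  induction x using TensorProduct.induction_on with
  | zero => simp
  | tmul a z =>
    rw [Algebra.TensorProduct.map_tmul, Algebra.TensorProduct.basis_repr_tmul,
      Algebra.TensorProduct.basis_repr_tmul]
    simp
    exact Or.inl (((σ : KSep k →ₐ[KInfty k] KSep k).restrictScalars (RatFunc k)).commutes _).symm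
  | add x y hx hy =>
    rw [map_add, map_add, map_add, Finsupp.add_apply, Finsupp.add_apply, map_add, hx, hy]

theorem basisSep_repr_toSep (x : KInf k K) (i : ι) :
    (basisSep K b).repr (toSep k K x) i =
      algebraMap (KInfty k) (KSep k) ((basisInf K b).repr x i) := by
  change (Algebra.TensorProduct.basis (KSep k) b).repr (Algebra.TensorProduct.map _ _ x) i =
    algebraMap (KInfty k) (KSep k) ((Algebra.TensorProduct.basis (KInfty k) b).repr x i)
  induction x using TensorProduct.induction_on with
  | zero => simp
  | tmul a z =>
    rw [Algebra.TensorProduct.map_tmul, Algebra.TensorProduct.basis_repr_tmul,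
      Algebra.TensorProduct.basis_repr_tmul]
    simp
    rw [Algebra.smul_def]
    rfl
  | add x y hx hy =>
    rw [map_add, map_add, map_add, Finsupp.add_apply, Finsupp.add_apply, map_add, hx, hy]

instance : T2Space (KInf k K) := by
  let b := Module.finBasis (KInfty k) (KInf k K)
  exact T2Space.of_injective_continuous b.equivFun.injective
    (IsModuleTopology.continuous_of_linearMap b.equivFun.toLinearMap)

instance : T2Space (KInfSep k K) := by
  let b := Module.finBasis (KSep k) (KInfSep k K)
  exact T2Space.of_injective_continuous b.equivFun.injective
    (IsModuleTopology.continuous_of_linearMap b.equivFun.toLinearMap)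

instance : ContinuousSMul (KInfty k) (KInf k K) := IsModuleTopology.toContinuousSMul _ _

instance : ContinuousSMul (KInfty k) (KInfSep k K) := by
  have : ContinuousSMul (KSep k) (KInfSep k K) := IsModuleTopology.toContinuousSMul _ _
  refine ⟨?_⟩
  have h : (fun p : KInfty k × KInfSep k K => p.1 • p.2) =
      fun p => algebraMap (KInfty k) (KSep k) p.1 • p.2 := by
    ext p
    rw [algebraMap_smul]
  rw [h]
  exact (continuous_algebraMap_KSep.comp continuous_fst).smul continuous_snd

instance : Algebra.IsIntegral (KInfty k) (KInf k K) := Algebra.IsIntegral.of_finite _ _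

instance : Algebra.IsIntegral (KInfty k) (KInfSep k K) := by
  have : Algebra.IsIntegral (KSep k) (KInfSep k K) := Algebra.IsIntegral.of_finite _ _
  exact Algebra.IsIntegral.trans (KSep k)

theorem toSep_injective : Function.Injective (toSep k K) := by
  intro x y h
  let b := Module.finBasis (RatFunc k) K
  refine (basisInf K b).repr.injective (Finsupp.ext fun i => ?_)
  apply (algebraMap (KInfty k) (KSep k)).injective
  rw [← basisSep_repr_toSep, ← basisSep_repr_toSep, h]

theorem galAct_toSep (σ : Gal k) (x : KInf k K) : galAct K σ (toSep k K x) = toSep k K x := by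
  let b := Module.finBasis (RatFunc k) K
  refine (basisSep K b).repr.injective (Finsupp.ext fun i => ?_)
  rw [basisSep_repr_galAct, basisSep_repr_toSep, AlgEquiv.commutes]

theorem galAct_mul (σ τ : Gal k) (x : KInfSep k K) :
    galAct K (σ * τ) x = galAct K σ (galAct K τ x) := by
  let b := Module.finBasis (RatFunc k) K
  refine (basisSep K b).repr.injective (Finsupp.ext fun i => ?_)
  rw [basisSep_repr_galAct, basisSep_repr_galAct, basisSep_repr_galAct, AlgEquiv.mul_apply]

theorem exists_toSep_eq {x : KInfSep k K} (hx : ∀ σ : Gal k, galAct K σ x = x) :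
    ∃ v, toSep k K v = x := by
  let b := Module.finBasis (RatFunc k) K
  have h : ∀ i, ∃ f, algebraMap (KInfty k) (KSep k) f = (basisSep K b).repr x i := fun i => by
    have h1 := (InfiniteGalois.mem_bot_iff_fixed (k := KInfty k) ((basisSep K b).repr x i)).mpr
      fun σ => by rw [← basisSep_repr_galAct, hx]
    exact IntermediateField.mem_bot.mp h1
  choose f hf using h
  refine ⟨∑ i, f i • basisInf K b i, (basisSep K b).repr.injective (Finsupp.ext fun i => ?_)⟩
  rw [basisSep_repr_toSep, Module.Basis.repr_sum_self, hf]

theorem isLocallyConstant_galAct (x : KInfSep k K) :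
    IsLocallyConstant fun σ : Gal k => galAct K σ x := by
  let b := Module.finBasis (RatFunc k) K
  let L := IntermediateField.adjoin (KInfty k) (Set.range fun i => (basisSep K b).repr x i)
  have : FiniteDimensional (KInfty k) L := by
    have : Finite (Set.range fun i => (basisSep K b).repr x i) := Set.finite_range _
    exact IntermediateField.finiteDimensional_adjoin
      (fun z _ => (Algebra.IsSeparable.isSeparable (KInfty k) z).isIntegral)
  rw [IsLocallyConstant.iff_eventually_eq]
  intro σ
  have hopen : (L.fixingSubgroup : Set (Gal k)) ∈ nhds (1 : Gal k) :=
    (IntermediateField.fixingSubgroup_isOpen L).mem_nhds (one_mem _)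
  have hcont : Filter.Tendsto (fun τ : Gal k => σ⁻¹ * τ) (nhds σ) (nhds 1) := by
    have := (continuous_const_mul σ⁻¹).tendsto σ
    rwa [inv_mul_cancel] at this
  filter_upwards [hcont hopen] with τ hτ
  rw [← mul_inv_cancel_left σ τ, galAct_mul]
  congr 1
  refine (basisSep K b).repr.injective (Finsupp.ext fun i => ?_)
  rw [basisSep_repr_galAct]
  exact (IntermediateField.mem_fixingSubgroup_iff _ _).mp hτ _
    (IntermediateField.subset_adjoin _ _ ⟨i, rfl⟩)

/-- Continuous cocycles of `G` with values in `K_∞^sep` are coboundaries. -/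
theorem exists_eq_galAct_sub {c : Gal k → KInfSep k K} (hc : IsLocallyConstant c)
    (h : ∀ σ τ, c (σ * τ) = c σ + galAct K σ (c τ)) : ∃ x, ∀ σ, c σ = galAct K σ x - x := by
  let b := Module.finBasis (RatFunc k) K
  have h1 : ∀ i, ∃ z, ∀ σ, (basisSep K b).repr (c σ) i = σ z - z := fun i => by
    refine exists_eq_sub_of_cocycle (hc.comp fun y => (basisSep K b).repr y i) fun σ τ => ?_
    rw [h, map_add, Finsupp.add_apply, basisSep_repr_galAct]
  choose z hz using h1
  refine ⟨∑ i, z i • basisSep K b i,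
    fun σ => (basisSep K b).repr.injective (Finsupp.ext fun i => ?_)⟩
  rw [map_sub, Finsupp.sub_apply, basisSep_repr_galAct, Module.Basis.repr_sum_self, hz]

end Descent

/-! ### The connecting map and its cokernel -/

section Connecting

variable {k : Type*} [Field k] [DecidableEq (RatFunc k)] [Fintype k]
variable {K : Type*} [Field K] [Algebra (RatFunc k) K] [FiniteDimensional (RatFunc k) K]

theorem hasExp_iff_expSum {B : Type*} [CommRing B] [TopologicalSpace B] [Algebra (RatFunc k) B]
    [Algebra k[X] B] [Algebra (KInfty k) B] [IsScalarTower (RatFunc k) (KInfty k) B] {x : B}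
    {y : Points k B} : HasExp x y ↔ ExpSum k x (Points.of.symm y) := by
  have h : (fun i => expCoeff k i • x ^ Fintype.card k ^ i) = expTerm k x :=
    funext fun i => (algebraMap_smul (KInfty k) _ _).symm
  rw [HasExp, h, ExpSum]

theorem HasExp.unique {x : KInfSep k K} {y y' : Points k (KInfSep k K)} (h : HasExp x y)
    (h' : HasExp x y') : y = y' :=
  Points.of.symm.injective (HasSum.unique h h')

theorem exists_hasExp_sep (y : Points k (KInfSep k K)) : ∃ x, HasExp x y := by
  obtain ⟨x, hx⟩ := exists_expSum_of_finite_isSepClosed (k := k) (KSep k) (Points.of.symm y)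
  exact ⟨x, hasExp_iff_expSum.mpr hx⟩

theorem pointsToSep_of (v : KInf k K) :
    pointsToSep k K (Points.of v) = Points.of (toSep k K v) := by
  simp [pointsToSep, Points.map]

theorem HasExp.galAct {x : KInfSep k K} {y : Points k (KInf k K)} (σ : Gal k)
    (h : HasExp x (pointsToSep k K y)) : HasExp (galAct K σ x) (pointsToSep k K y) := by
  obtain ⟨v, rfl⟩ := Points.of.surjective y
  rw [pointsToSep_of, hasExp_iff_expSum, AddEquiv.symm_apply_apply] at h ⊢
  have h1 := h.map (galActInfty K σ) (Algebra.IsIntegral.isIntegral x)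
  have h2 : galActInfty K σ (toSep k K v) = toSep k K v := galAct_toSep σ v
  rwa [h2] at h1

theorem HasExp.sub {x x' : KInfSep k K} {y y' : Points k (KInfSep k K)} (h : HasExp x y)
    (h' : HasExp x' y') : HasExp (x - x') (y - y') := by
  have := h.add (h'.smul (-1 : k[X]))
  simpa [sub_eq_add_neg] using this

/-- The cocycle `σ ↦ σ x - x` attached to `x` with `exp_E(x)` in `E(K_∞)`. -/
def cocycleOf {x : KInfSep k K} {y : Points k (KInf k K)} (h : HasExp x (pointsToSep k K y)) :
    cocycles k K :=
  ⟨fun σ => galAct K σ x - x, (isLocallyConstant_galAct x).comp (· - x), fun σ => by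
    have h1 := (h.galAct σ).sub h
    rwa [sub_self] at h1, fun σ τ => by
    change galAct K (σ * τ) x - x = (galAct K σ x - x) + galAct K σ (galAct K τ x - x)
    rw [galAct_mul, map_sub]
    abel⟩

theorem mem_connectingGraph {y : Points k (KInf k K)} {c : H1 k K} :
    (y, c) ∈ connectingGraph k K ↔ ∃ (z : cocycles k K) (x : KInfSep k K),
      Submodule.Quotient.mk z = c ∧ HasExp x (pointsToSep k K y) ∧
        ∀ σ, z.1 σ = galAct K σ x - x := Iff.rfl

variable (k K) in
/-- The connecting map `E(K_∞) → H¹(G, Λ_E)` exists because the exponential is surjective on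
`K_∞^sep`, and it is well defined because two preimages of a point differ by a period. -/
theorem exists_connectingMap : ∃ δ : Points k (KInf k K) →ₗ[k[X]] H1 k K,
    δ.graph = connectingGraph k K := by
  obtain ⟨δ, hδ⟩ := Submodule.exists_eq_graph (G := connectingGraph k K) ⟨by
    rintro ⟨⟨y, c⟩, hc⟩ ⟨⟨y', c'⟩, hc'⟩ (h : y = y')
    subst h
    obtain ⟨z, x, rfl, hx, hz⟩ := mem_connectingGraph.mp hc
    obtain ⟨z', x', rfl, hx', hz'⟩ := mem_connectingGraph.mp hc'
    refine Subtype.ext (Prod.ext rfl ((Submodule.Quotient.eq _).mpr ⟨x - x', ?_, fun σ => ?_⟩))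
    · have h1 := hx.sub hx'
      rwa [sub_self] at h1
    · change z.1 σ - z'.1 σ = _
      rw [hz, hz', map_sub]
      abel, fun y => by
    obtain ⟨x, hx⟩ := exists_hasExp_sep (pointsToSep k K y)
    exact ⟨⟨(y, Submodule.Quotient.mk (cocycleOf hx)),
      cocycleOf hx, x, rfl, hx, fun σ => rfl⟩, rfl⟩⟩
  exact ⟨δ, hδ.symm⟩

variable (k K) in
theorem exists_expInf : ∃ e : KInf k K →+ KInf k K, ∀ x, ExpSum k x (e x) := by
  have h : ∀ x : KInf k K, ∃ y, ExpSum k x y := exists_expSum_of_finite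
  choose e he using h
  exact ⟨AddMonoidHom.mk' e fun x y => (he (x + y)).unique ((he x).add (he y)), he⟩

variable (k K) in
/-- The exponential `exp_E : Lie_E(K_∞) → E(K_∞)`, as an additive map from `K_∞` to itself. -/
def expInf : KInf k K →+ KInf k K := (exists_expInf k K).choose

theorem expSum_expInf (x : KInf k K) : ExpSum k x (expInf k K x) :=
  (exists_expInf k K).choose_spec x

theorem hasExp_iff_expInf {x : KInf k K} {y : Points k (KInf k K)} :
    HasExp x y ↔ expInf k K x = Points.of.symm y := by
  rw [hasExp_iff_expSum]
  exact ⟨fun h => (expSum_expInf x).unique h, fun h => h ▸ expSum_expInf x⟩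

theorem hasExp_toSep (x : KInf k K) :
    HasExp (toSep k K x) (pointsToSep k K (Points.of (expInf k K x))) := by
  rw [pointsToSep_of, hasExp_iff_expSum, AddEquiv.symm_apply_apply]
  exact (expSum_expInf x).map (toSepInfty K) (Algebra.IsIntegral.isIntegral x)

/-- The kernel of the connecting map is `exp_E(Lie_E(K_∞))`, by Galois descent. -/
theorem connectingMap_eq_zero_iff {δ : Points k (KInf k K) →ₗ[k[X]] H1 k K}
    (hδ : δ.graph = connectingGraph k K) (v : KInf k K) :
    δ (Points.of v) = 0 ↔ v ∈ (expInf k K).range := by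
  have hgraph : δ (Points.of v) = 0 ↔ (Points.of v, (0 : H1 k K)) ∈ connectingGraph k K := by
    rw [← hδ, LinearMap.mem_graph_iff, eq_comm]
  rw [hgraph, mem_connectingGraph]
  constructor
  · rintro ⟨z, x, hz0, hx, hz⟩
    obtain ⟨l, hl, hlz⟩ := (Submodule.Quotient.mk_eq_zero _).mp hz0
    obtain ⟨w, hw⟩ := exists_toSep_eq (x := x - l) fun σ => by
      have h1 := hz σ
      rw [hlz] at h1
      rw [map_sub, sub_eq_sub_iff_sub_eq_sub, ← h1]
    refine ⟨w, toSep_injective ?_⟩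
    have h2 : HasExp (x - l) (pointsToSep k K (Points.of v)) := by
      simpa using hx.sub hl
    rw [← hw] at h2
    have h3 := (hasExp_toSep w).unique h2
    rw [pointsToSep_of, pointsToSep_of] at h3
    exact Points.of.injective h3
  · rintro ⟨w, rfl⟩
    exact ⟨0, toSep k K w, rfl, hasExp_toSep w, fun σ => by simp [galAct_toSep]⟩

/-- The connecting map is surjective, by Hilbert's Theorem 90. -/
theorem connectingMap_surjective {δ : Points k (KInf k K) →ₗ[k[X]] H1 k K}
    (hδ : δ.graph = connectingGraph k K) : Function.Surjective δ := by
  intro c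
  obtain ⟨z, rfl⟩ := Submodule.Quotient.mk_surjective _ c
  obtain ⟨x, hx⟩ := exists_eq_galAct_sub z.2.1 z.2.2.2
  obtain ⟨y, -, hy⟩ := exists_expSum_mem_adjoin (k := k)
    (Algebra.IsIntegral.isIntegral (R := KInfty k) x)
  obtain ⟨v, hv⟩ := exists_toSep_eq (x := (y : KInfSep k K)) fun σ => by
    have h1 : HasExp (z.1 σ) (0 : Points k (KInfSep k K)) := z.2.2.1 σ
    rw [hasExp_iff_expSum, hx σ, map_zero] at h1
    have h2 : ExpSum k (galAct K σ x) (galAct K σ (y : KInfSep k K)) :=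
      hy.map (galActInfty K σ) (Algebra.IsIntegral.isIntegral x)
    exact sub_eq_zero.mp ((h2.sub hy).unique h1)
  refine ⟨Points.of v, ?_⟩
  have hmem : (Points.of v, Submodule.Quotient.mk z) ∈ connectingGraph k K := by
    refine ⟨z, x, rfl, ?_, hx⟩
    rw [pointsToSep_of, hv, hasExp_iff_expSum, AddEquiv.symm_apply_apply]
    exact hy
  rw [← hδ, LinearMap.mem_graph_iff] at hmem
  exact hmem.symm

variable [Algebra k[X] K] [IsScalarTower k[X] (RatFunc k) K]

variable (k K) in
/-- The image of `R` in `K_∞`. -/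
def ringLattice : Submodule k[X] (KInf k K) := LinearMap.range (ringToInf k K).toLinearMap

theorem integralPoints_of (r : IntegralRing k K) :
    integralPoints k K (Points.of r) = Points.of (ringToInf k K r) := by
  simp [integralPoints, Points.map]

theorem mem_expInv {x : KInf k K} : x ∈ expInv k K ↔ expInf k K x ∈ ringLattice k K := by
  constructor
  · rintro ⟨r, hr⟩
    obtain ⟨r, rfl⟩ := Points.of.surjective r
    rw [integralPoints_of, hasExp_iff_expInf, AddEquiv.symm_apply_apply] at hr
    exact ⟨r, hr.symm⟩
  · rintro ⟨r, hr⟩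
    refine ⟨Points.of r, ?_⟩
    rw [integralPoints_of, hasExp_iff_expInf, AddEquiv.symm_apply_apply]
    exact hr.symm

variable (k K) in
/-- As a group, `H_R` is the quotient of `K_∞` by `R + exp_E(K_∞)`. -/
theorem card_HR : Nat.card (HR k K) =
    ((ringLattice k K).toAddSubgroup ⊔ (expInf k K).range).index := by
  obtain ⟨δ, hδ⟩ := exists_connectingMap k K
  let f : KInf k K →+ HR k K :=
    ((integralImage k K).mkQ.comp δ).toAddMonoidHom.comp Points.of.toAddMonoidHom
  have hf : Function.Surjective f :=
    (Submodule.mkQ_surjective _).comp ((connectingMap_surjective hδ).comp Points.of.surjective)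
  have hker : f.ker = (ringLattice k K).toAddSubgroup ⊔ (expInf k K).range := by
    ext v
    have h1 : v ∈ f.ker ↔ δ (Points.of v) ∈ integralImage k K :=
      Submodule.Quotient.mk_eq_zero _
    have h2 : δ (Points.of v) ∈ integralImage k K ↔
        ∃ r, δ (Points.of (ringToInf k K r)) = δ (Points.of v) := by
      have h3 : ∀ (p : Points k (KInf k K)) c, (p, c) ∈ connectingGraph k K ↔ c = δ p :=
        fun p c => by rw [← hδ, LinearMap.mem_graph_iff]
      constructor
      · rintro ⟨r, hr⟩
        obtain ⟨r, rfl⟩ := Points.of.surjective r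
        rw [integralPoints_of, h3] at hr
        exact ⟨r, hr.symm⟩
      · rintro ⟨r, hr⟩
        refine ⟨Points.of r, ?_⟩
        rw [integralPoints_of, h3]
        exact hr.symm
    rw [h1, h2, AddSubgroup.mem_sup]
    constructor
    · rintro ⟨r, hr⟩
      refine ⟨ringToInf k K r, ⟨r, rfl⟩, v - ringToInf k K r, ?_, add_sub_cancel _ _⟩
      rw [← connectingMap_eq_zero_iff hδ, map_sub, map_sub, hr, sub_self]
    · rintro ⟨_, ⟨r, rfl⟩, e, he, rfl⟩
      refine ⟨r, ?_⟩
      rw [map_add, map_add, (connectingMap_eq_zero_iff hδ e).mpr he, add_zero]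
      rfl
  rw [← hker, AddSubgroup.index_ker, AddMonoidHom.range_eq_top.mpr hf, AddSubgroup.card_top]

end Connecting

/-! ### The index formula -/

section Index

variable {k : Type*} [Field k] [DecidableEq (RatFunc k)] [Fintype k]
variable {K : Type*} [Field K] [Algebra (RatFunc k) K] [FiniteDimensional (RatFunc k) K]

theorem basisInf_repr_ofField {ι : Type*} (b : Module.Basis ι (RatFunc k) K) (z : K) (i : ι) :
    (basisInf K b).repr (ofField k K z) i = algebraMap (RatFunc k) (KInfty k) (b.repr z i) := by
  change (Algebra.TensorProduct.basis (KInfty k) b).repr (1 ⊗ₜ[RatFunc k] z) i = _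
  rw [Algebra.TensorProduct.basis_repr_tmul]
  simp

theorem valued_det_lt_one {ι : Type*} [Fintype ι] [DecidableEq ι] [Nonempty ι]
    {A : Matrix ι ι (KInfty k)} (hA : ∀ i j, Valued.v (A i j) < (1 : ℤᵐ⁰)) :
    Valued.v A.det < (1 : ℤᵐ⁰) := by
  rw [Matrix.det_apply]
  refine Valuation.map_sum_lt _ one_ne_zero fun σ _ => ?_
  have h1 : Valued.v (∏ i, A (σ i) i) < (1 : ℤᵐ⁰) := by
    rw [map_prod]
    obtain ⟨j⟩ := ‹Nonempty ι›
    rw [← Finset.mul_prod_erase _ _ (Finset.mem_univ j)]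
    exact (mul_le_of_le_one_right' (Finset.prod_le_one' fun i _ => (hA _ _).le)).trans_lt (hA _ _)
  rcases Int.units_eq_one_or (Equiv.Perm.sign σ) with h | h
  · rwa [h, one_smul]
  · rwa [h, Units.neg_smul, one_smul, Valuation.map_neg]

variable [Algebra k[X] K] [IsScalarTower k[X] (RatFunc k) K]

/-- The ring `R` is discrete in `K_∞`: the norm of a nonzero element is a nonzero polynomial,
whereas norms of small elements are small. -/
theorem exists_radius_ringLattice {ι : Type*} [Fintype ι] (b : Module.Basis ι (RatFunc k) K) :
    ∃ ρ : ℝ, 0 < ρ ∧ ∀ v ∈ ringLattice k K, ‖(basisInf K b).equivFun v‖ < ρ → v = 0 := by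
  classical
  obtain ⟨C, hC, hmul⟩ := exists_norm_mul_le (basisInf K b)
  set D := C * (1 + ∑ j, ‖(basisInf K b).equivFun (basisInf K b j)‖)
  have hD : 0 < D := by positivity
  have : Nonempty ι := b.index_nonempty
  refine ⟨1 / D, by positivity, ?_⟩
  rintro _ ⟨r, rfl⟩ hr
  change ringToInf k K r = 0
  change ‖(basisInf K b).equivFun (ofField k K r)‖ < 1 / D at hr
  have hdet : Valued.v (algebraMap (RatFunc k) (KInfty k) (Algebra.norm (RatFunc k) (r : K))) <
      (1 : ℤᵐ⁰) := by
    rw [Algebra.norm_eq_matrix_det b, RingHom.map_det]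
    refine valued_det_lt_one fun i j => ?_
    rw [RingHom.mapMatrix_apply, Matrix.map_apply, Algebra.leftMulMatrix_eq_repr_mul,
      ← basisInf_repr_ofField, map_mul, ← basisInf_apply, ← norm_lt_one_iff]
    calc ‖(basisInf K b).equivFun (ofField k K r * basisInf K b j) i‖
        ≤ ‖(basisInf K b).equivFun (ofField k K r * basisInf K b j)‖ := norm_le_pi_norm _ _
      _ ≤ C * ‖(basisInf K b).equivFun (ofField k K r)‖ *
          ‖(basisInf K b).equivFun (basisInf K b j)‖ := hmul _ _
      _ ≤ C * ‖(basisInf K b).equivFun (ofField k K r)‖ *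
          (1 + ∑ j, ‖(basisInf K b).equivFun (basisInf K b j)‖) := by
        gcongr
        have := Finset.single_le_sum
          (fun j _ => norm_nonneg ((basisInf K b).equivFun (basisInf K b j)))
          (Finset.mem_univ j)
        linarith
      _ = ‖(basisInf K b).equivFun (ofField k K r)‖ * D := by ring
      _ < 1 := by rwa [lt_div_iff₀ hD] at hr
  have hint : IsIntegral k[X] (Algebra.norm (RatFunc k) (r : K)) :=
    Algebra.isIntegral_norm (RatFunc k) r.2
  obtain ⟨p, hp⟩ := IsIntegrallyClosed.isIntegral_iff.mp hint
  rw [← hp, ← IsScalarTower.algebraMap_apply] at hdet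
  rw [polynomial_eq_zero_of_valued_lt_one hdet, map_zero, eq_comm, Algebra.norm_eq_zero_iff] at hp
  have : r = 0 := Subtype.ext hp
  rw [this, map_zero]

variable (k K) in
/-- The ring `R` contains a basis of `K` over `k(t)`. -/
theorem exists_basis_integral :
    ∃ b : Module.Basis (Fin (Module.finrank (RatFunc k) K)) (RatFunc k) K,
    ∀ i, basisInf K b i ∈ ringLattice k K := by
  classical
  let b := Module.finBasis (RatFunc k) K
  obtain ⟨p, hp0, hp⟩ := exists_integral_multiples k[X] (RatFunc k) (Finset.univ.image b)
  have hp1 : algebraMap k[X] (RatFunc k) p ≠ 0 := by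
    simpa using hp0
  refine ⟨b.unitsSMul fun _ => Units.mk0 _ hp1, fun i => ?_⟩
  have hint := hp (b i) (by simp)
  refine ⟨⟨p • b i, hint⟩, ?_⟩
  rw [basisInf_apply, Module.Basis.unitsSMul_apply, Units.smul_def, Units.val_mk0, algebraMap_smul]
  rfl

/-- The index formula. In a small box `B` the exponential is an isometric bijection, so that
`K_∞ / (U + B)` embeds into `K_∞ / (R + B)` with cokernel `H_R`, where `U = exp_E⁻¹(R)`. Comparing
the indices of both lattices modulo `B` gives the covolume of `U` relative to that of `R`. -/
theorem exists_bases : ∃ (h : ℕ)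
    (l l' : Module.Basis (Fin (Module.finrank (RatFunc k) K)) (KInfty k) (KInf k K)),
    Nat.card (HR k K) = Fintype.card k ^ h ∧
    Submodule.span k[X] (Set.range l) = ringLattice k K ∧
    Submodule.span k[X] (Set.range l') = expInv k K ∧
    Valued.v (l.det l') = WithZero.exp (-(h : ℤ)) := by
  obtain ⟨b, hb⟩ := exists_basis_integral k K
  set r := basisInf K b
  obtain ⟨ρ₁, hρ₁, hR⟩ := exists_radius_ringLattice b
  obtain ⟨ρ₂, hρ₂, hexp⟩ := exists_radius r
  obtain ⟨N, hN⟩ := exists_pow_lt_of_lt_one (lt_min hρ₁ hρ₂) (show (1 / 2 : ℝ) < 1 by norm_num)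
  have hN1 := hN.trans_le (min_le_left _ _)
  have hN2 := hN.trans_le (min_le_right _ _)
  set B := box (shrink r N) with hB
  have hmem : ∀ v, v ∈ B ↔ ‖r.equivFun v‖ < (1 / 2) ^ N := fun v => by
    rw [hB, mem_box_shrink, pi_norm_lt_iff (by positivity)]
    rfl
  let φ : KInf k K ≃L[KInfty k] (Fin _ → KInfty k) := r.equivFun.toContinuousLinearEquiv
  set e := expInf k K
  set Λ := ringLattice k K
  -- `exp_E - id` shrinks norms on `B`
  have hsub : ∀ v ∈ B, ‖r.equivFun (e v - v)‖ ≤ 1 / 2 * ‖r.equivFun v‖ := fun v hv =>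
    (expSum_expInf v).norm_sub_le φ hexp (((hmem v).mp hv).trans hN2).le
  have heB : ∀ v ∈ B, e v ∈ B := fun v hv => by
    rw [← sub_add_cancel (e v) v]
    refine B.add_mem ((hmem _).mpr ?_) hv
    linarith [hsub v hv, (hmem v).mp hv, norm_nonneg (r.equivFun v)]
  have hsurj : ∀ v ∈ B, ∃ w ∈ B, e w = v := fun v hv => by
    obtain ⟨w, hw, hwv⟩ := exists_expSum_of_norm_le φ exists_expSum_of_finite hexp
      (((hmem v).mp hv).trans hN2).le
    exact ⟨w, (hmem w).mpr (lt_of_le_of_lt hw ((hmem v).mp hv)), (expSum_expInf w).unique hwv⟩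
  have hΛB : ∀ v ∈ Λ, v ∈ B → v = 0 := fun v hv hvB => hR v hv (((hmem v).mp hvB).trans hN1)
  have hUB : ∀ v ∈ expInv k K, v ∈ B → v = 0 := fun v hv hvB => by
    have h0 := hΛB _ (mem_expInv.mp hv) (heB v hvB)
    have h1 := hsub v hvB
    rw [h0, zero_sub, map_neg, norm_neg] at h1
    have h2 : ‖r.equivFun v‖ = 0 := by linarith [norm_nonneg (r.equivFun v)]
    simpa using h2
  have hcomap : (Λ.toAddSubgroup ⊔ B).comap e = (expInv k K).toAddSubgroup ⊔ B := by
    ext v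
    rw [AddSubgroup.mem_comap, AddSubgroup.mem_sup, AddSubgroup.mem_sup]
    constructor
    · rintro ⟨y, hy, c, hc, hyc⟩
      obtain ⟨w, hw, rfl⟩ := hsurj c hc
      refine ⟨v - w, mem_expInv.mpr ?_, w, hw, sub_add_cancel _ _⟩
      change e (v - w) ∈ Λ
      rw [map_sub, ← hyc, add_sub_cancel_right]
      exact hy
    · rintro ⟨u, hu, w, hw, rfl⟩
      exact ⟨e u, mem_expInv.mp hu, e w, heB w hw, (map_add e u w).symm⟩
  have hle : B ≤ e.range := fun v hv => by
    obtain ⟨w, -, hw⟩ := hsurj v hv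
    exact ⟨w, hw⟩
  have hindex : ((expInv k K).toAddSubgroup ⊔ B).index * Nat.card (HR k K) =
      (Λ.toAddSubgroup ⊔ B).index := by
    have h2 : (Λ.toAddSubgroup ⊔ B).relIndex (e.range ⊔ (Λ.toAddSubgroup ⊔ B)) =
        (Λ.toAddSubgroup ⊔ B).relIndex e.range := AddSubgroup.relIndex_sup_right ..
    rw [← hcomap, AddSubgroup.index_comap, ← h2, card_HR]
    have h1 : e.range ⊔ (Λ.toAddSubgroup ⊔ B) = Λ.toAddSubgroup ⊔ e.range := by
      rw [sup_comm, sup_assoc, sup_eq_right.mpr hle]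
    rw [h1]
    exact AddSubgroup.relIndex_mul_index (sup_le_sup_left hle _)
  have hΛ0 : (Λ.toAddSubgroup ⊔ B).index ≠ 0 := index_sup_box_ne_zero r Λ hb N
  have hU0 : ((expInv k K).toAddSubgroup ⊔ B).index ≠ 0 := left_ne_zero_of_mul (hindex ▸ hΛ0)
  obtain ⟨l, m, hl, hm, hdet⟩ := exists_basis_of_index_ne_zero Λ _ (shrink r N) hΛB rfl hΛ0
  obtain ⟨l', m', hl', hm', hdet'⟩ :=
    exists_basis_of_index_ne_zero (expInv k K) _ (shrink r N) hUB rfl hU0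
  have hq : 1 < Fintype.card k := Fintype.one_lt_card
  rw [hm, hm'] at hindex
  have hmm : m' ≤ m := (Nat.pow_dvd_pow_iff_le_right hq).mp (Dvd.intro _ hindex)
  refine ⟨m - m', l, l', ?_, hl, hl', ?_⟩
  · refine Nat.eq_of_mul_eq_mul_left (pow_pos (by omega : 0 < Fintype.card k) m') ?_
    rw [hindex, ← pow_add, Nat.add_sub_cancel' hmm]
  · have h1 : (shrink r N).det l' = (shrink r N).det l * l.det l' := by
      rw [Module.Basis.det_apply, Module.Basis.det_apply, Module.Basis.det_apply, ← Matrix.det_mul,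
        Module.Basis.toMatrix_mul_toMatrix]
    rw [h1, map_mul, hdet] at hdet'
    have h2 : Valued.v (l.det l') = (WithZero.exp (m : ℤ))⁻¹ * WithZero.exp (m' : ℤ) := by
      rw [← hdet', inv_mul_cancel_left₀ WithZero.exp_ne_zero]
    rw [h2, ← WithZero.exp_neg, ← WithZero.exp_add]
    congr 1
    omega

end Index

/-! ### The regulator -/

section Regulator

variable {k : Type*} [Field k] [DecidableEq (RatFunc k)]

theorem valued_unit (u : k[X]ˣ) : Valued.v (algebraMap k[X] (KInfty k) u) = (1 : ℤᵐ⁰) := by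
  rw [valued_polynomial u.ne_zero, Polynomial.natDegree_coe_units]
  rfl

/-- Every nonzero element of `k((1/t))` has a unique monic multiple by a unit of `k[t]`. -/
theorem existsUnique_isMonic {f : KInfty k} (hf : f ≠ 0) :
    ∃! r : KInfty k, IsMonic r ∧ ∃ u : k[X]ˣ, r = (u : k[X]) • f := by
  have hT : ∀ n : ℤ, algebraMap (RatFunc k) (KInfty k) RatFunc.X ^ n = tInf k ^ n := fun n => rfl
  have ht : ∀ n : ℤ, tInf k ^ n ≠ 0 := fun n => zpow_ne_zero n tInf_ne_zero
  have hv0 : (Valued.v f : ℤᵐ⁰) ≠ 0 := (Valuation.ne_zero_iff _).mpr hf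
  refine existsUnique_of_exists_of_unique ?_ ?_
  · obtain ⟨n, hn⟩ : ∃ n : ℤ, Valued.v f = WithZero.exp n := ⟨_, (WithZero.exp_log hv0).symm⟩
    have h1 : Valued.v ((tInf k ^ n)⁻¹ * f) = (1 : ℤᵐ⁰) := by
      rw [map_mul, map_inv₀, valued_tInf_zpow, hn, inv_mul_cancel₀ WithZero.exp_ne_zero]
    obtain ⟨a, ha⟩ := exists_constant_part h1.le
    have ha0 : a ≠ 0 := by
      rintro rfl
      rw [map_zero, map_zero, sub_zero, h1] at ha
      exact lt_irrefl _ ha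
    -- the leading coefficient `a` of `f` has to be divided out
    let u : k[X]ˣ := Units.map Polynomial.C.toMonoidHom (Units.mk0 a ha0)⁻¹
    have hu : (u : k[X]) = Polynomial.C a⁻¹ := rfl
    refine ⟨(u : k[X]) • f, ⟨n, ?_⟩, u, rfl⟩
    rw [hT, hu, polynomial_smul_eq, smul_eq_mul]
    have h2 : algebraMap k[X] (KInfty k) (Polynomial.C a⁻¹) *
        algebraMap k[X] (KInfty k) (Polynomial.C a) = 1 := by
      rw [← map_mul, ← map_mul, inv_mul_cancel₀ ha0, map_one, map_one]
    have h3 : algebraMap k[X] (KInfty k) (Polynomial.C a⁻¹) * f - tInf k ^ n =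
        algebraMap k[X] (KInfty k) (Polynomial.C a⁻¹) * tInf k ^ n *
          ((tInf k ^ n)⁻¹ * f - algebraMap k[X] (KInfty k) (Polynomial.C a)) := by
      have h4 := mul_inv_cancel₀ (ht n)
      linear_combination
        (-(algebraMap k[X] (KInfty k) (Polynomial.C a⁻¹)) * f) * h4 + tInf k ^ n * h2
    rw [h3, map_mul, map_mul, ← hu, valued_unit, one_mul]
    exact mul_lt_of_lt_one_right (zero_lt_iff.mpr ((Valuation.ne_zero_iff _).mpr (ht n))) ha
  · rintro r r' ⟨⟨n, hr⟩, u, rfl⟩ ⟨⟨m, hr'⟩, u', rfl⟩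
    simp only [hT, polynomial_smul_eq, smul_eq_mul] at hr hr' ⊢
    have hval : ∀ (u : k[X]ˣ) (n : ℤ), Valued.v (algebraMap k[X] (KInfty k) u * f - tInf k ^ n) <
        (Valued.v (tInf k ^ n) : ℤᵐ⁰) → Valued.v f = WithZero.exp n := by
      intro u n h
      have h1 := Valuation.map_add_eq_of_lt_left _ h
      rw [add_sub_cancel, map_mul, valued_unit, one_mul, valued_tInf_zpow] at h1
      exact h1
    have hnm : n = m := by
      have h1 := (hval u n hr).symm.trans (hval u' m hr')
      simpa using h1
    subst hnm
    have hd : Valued.v (algebraMap k[X] (KInfty k) (u - u') * f) < (Valued.v f : ℤᵐ⁰) := by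
      have h1 : algebraMap k[X] (KInfty k) (u - u') * f =
          (algebraMap k[X] (KInfty k) u * f - tInf k ^ n) -
            (algebraMap k[X] (KInfty k) u' * f - tInf k ^ n) := by
        rw [map_sub]
        ring
      rw [h1]
      refine Valuation.map_sub_lt _ ?_ ?_
      · rwa [hval u n hr, ← valued_tInf_zpow (k := k)]
      · rwa [hval u n hr, ← valued_tInf_zpow (k := k)]
    rw [map_mul] at hd
    have h2 : Valued.v (algebraMap k[X] (KInfty k) (u - u')) < (1 : ℤᵐ⁰) := by
      by_contra h
      exact absurd hd (not_lt.mpr (le_mul_of_one_le_left' (not_lt.mp h)))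
    rw [sub_eq_zero.mp (polynomial_eq_zero_of_valued_lt_one h2)]

variable [Fintype k]
variable {K : Type*} [Field K] [Algebra (RatFunc k) K] [FiniteDimensional (RatFunc k) K]
variable [Algebra k[X] K] [IsScalarTower k[X] (RatFunc k) K]

/-- The `k((1/t))`-basis of `K_∞` given by a `k[t]`-basis of `R`. -/
def lieBasis {n : ℕ} (c : Module.Basis (Fin n) k[X] (IntegralRing k K)) :
    Module.Basis (Fin n) (KInfty k) (KInf k K) :=
  (c.baseChange (KInfty k)).map (lieEquiv k K)

theorem lieEquiv_tmul (f : KInfty k) (r : IntegralRing k K) :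
    lieEquiv k K (f ⊗ₜ r) = f • ringToInf k K r :=
  (isBaseChange_ringToInf k K).equiv_tmul f r

theorem lieBasis_apply {n : ℕ} (c : Module.Basis (Fin n) k[X] (IntegralRing k K)) (i : Fin n) :
    lieBasis c i = ringToInf k K (c i) := by
  rw [lieBasis, Module.Basis.map_apply, Module.Basis.baseChange_apply, lieEquiv_tmul, one_smul]

theorem span_lieBasis {n : ℕ} (c : Module.Basis (Fin n) k[X] (IntegralRing k K)) :
    Submodule.span k[X] (Set.range (lieBasis c)) = ringLattice k K := by
  have h : Set.range (lieBasis c) = (ringToInf k K).toLinearMap '' Set.range c := by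
    rw [← Set.range_comp]
    exact congrArg Set.range (funext (lieBasis_apply c))
  rw [h, Submodule.span_image, c.span_eq, Submodule.map_top]
  rfl

/-- The determinant of `ρ` is that of a basis of `exp_E⁻¹(E(R))` in the coordinates of a basis of
`R`. -/
theorem det_rho {n : ℕ} (b : Module.Basis (Fin n) k[X] (expInv k K))
    (c : Module.Basis (Fin n) k[X] (IntegralRing k K)) :
    (LinearMap.toMatrix (b.baseChange (KInfty k)) (c.baseChange (KInfty k)) (rho k K)).det =
      (lieBasis c).det fun j => (b j : KInf k K) := by
  rw [Module.Basis.det_apply]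
  congr 1
  ext i j
  rw [LinearMap.toMatrix_apply, Module.Basis.toMatrix_apply, Module.Basis.baseChange_apply,
    lieBasis, Module.Basis.map_repr]
  simp [rho]

theorem ringToInf_injective : Function.Injective (ringToInf k K) :=
  (Algebra.TensorProduct.includeRight_injective (R := RatFunc k) (A := KInfty k) (B := K)
    (algebraMap (RatFunc k) (KInfty k)).injective).comp Subtype.val_injective

section

variable {V : Type*} [AddCommGroup V] [Module (KInfty k) V] [Module k[X] V]
  [IsScalarTower k[X] (KInfty k) V]

/-- A basis of the vector space `V` that spans a `k[t]`-submodule is a basis of this submodule. -/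
def latticeBasis {n : ℕ} (l : Module.Basis (Fin n) (KInfty k) V) {U : Submodule k[X] V}
    (h : Submodule.span k[X] (Set.range l) = U) : Module.Basis (Fin n) k[X] U :=
  have : Module.IsTorsionFree k[X] (KInfty k) :=
    Module.isTorsionFree_iff_algebraMap_injective.mpr algebraMap_polynomial_injective
  (l.restrictScalars k[X]).map (LinearEquiv.ofEq _ _ h)

theorem latticeBasis_apply {n : ℕ} (l : Module.Basis (Fin n) (KInfty k) V) {U : Submodule k[X] V}
    (h : Submodule.span k[X] (Set.range l) = U) (i : Fin n) : (latticeBasis l h i : V) = l i := by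
  simp [latticeBasis]

theorem algebraMap_latticeBasis_repr {n : ℕ} (l : Module.Basis (Fin n) (KInfty k) V)
    {U : Submodule k[X] V} (h : Submodule.span k[X] (Set.range l) = U) (x : U) (i : Fin n) :
    algebraMap k[X] (KInfty k) ((latticeBasis l h).repr x i) = l.repr x i := by
  subst h
  have : Module.IsTorsionFree k[X] (KInfty k) :=
    Module.isTorsionFree_iff_algebraMap_injective.mpr algebraMap_polynomial_injective
  exact l.restrictScalars_repr_apply k[X] x i

/-- Two bases of the same `k[t]`-lattice differ by a matrix whose determinant is a unit of
`k[t]`. -/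
theorem exists_det_eq_unit {n : ℕ} (l : Module.Basis (Fin n) (KInfty k) V) {U : Submodule k[X] V}
    (h : Submodule.span k[X] (Set.range l) = U) (b : Module.Basis (Fin n) k[X] U) :
    ∃ u : k[X]ˣ, l.det (fun j => (b j : V)) = algebraMap k[X] (KInfty k) u := by
  refine ⟨((latticeBasis l h).isUnit_det b).unit, ?_⟩
  rw [IsUnit.unit_spec, Module.Basis.det_apply, Module.Basis.det_apply, RingHom.map_det]
  congr 1
  ext i j
  exact (algebraMap_latticeBasis_repr l h (b j) i).symm

end

/-- The regulator is the monic representative of the determinant of any pair of bases of `K_∞`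
that span the lattices `R` and `exp_E⁻¹(E(R))`. -/
theorem isRegulator_iff
    {l l' : Module.Basis (Fin (Module.finrank (RatFunc k) K)) (KInfty k) (KInf k K)}
    (hl : Submodule.span k[X] (Set.range l) = ringLattice k K)
    (hl' : Submodule.span k[X] (Set.range l') = expInv k K) (r : KInfty k) :
    IsRegulator k K r ↔ IsMonic r ∧ ∃ u : k[X]ˣ, r = (u : k[X]) • l.det l' := by
  refine and_congr_right fun _ => ⟨?_, ?_⟩
  · rintro ⟨n, b, c, u, rfl⟩
    obtain rfl : n = Module.finrank (RatFunc k) K := by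
      have h1 := Module.finrank_eq_card_basis (lieBasis c)
      rw [Module.finrank_eq_card_basis l] at h1
      simpa using h1.symm
    obtain ⟨w, hw⟩ := exists_det_eq_unit l' hl' b
    obtain ⟨w', hw'⟩ := exists_det_eq_unit (lieBasis c) (span_lieBasis c) (latticeBasis l hl)
    simp only [latticeBasis_apply] at hw'
    refine ⟨u * w' * w, ?_⟩
    rw [det_rho]
    have h1 : (lieBasis c).det (fun j => (b j : KInf k K)) =
        (lieBasis c).det l * l.det l' * l'.det fun j => (b j : KInf k K) := by
      simp only [Module.Basis.det_apply]
      rw [← Matrix.det_mul, ← Matrix.det_mul, Module.Basis.toMatrix_mul_toMatrix,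
        Module.Basis.toMatrix_mul_toMatrix]
    rw [h1, hw, hw']
    simp only [polynomial_smul_eq, smul_eq_mul, Units.val_mul, map_mul]
    ring
  · rintro ⟨u, rfl⟩
    let f : IntegralRing k K ≃ₗ[k[X]] ringLattice k K :=
      LinearEquiv.ofInjective (ringToInf k K).toLinearMap ringToInf_injective
    let c : Module.Basis (Fin (Module.finrank (RatFunc k) K)) k[X] (IntegralRing k K) :=
      (latticeBasis l hl).map f.symm
    refine ⟨_, latticeBasis l' hl', c, u, ?_⟩
    have hc : lieBasis c = l := by
      refine Module.Basis.eq_of_apply_eq fun i => ?_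
      rw [lieBasis_apply, ← latticeBasis_apply l hl]
      exact congrArg Subtype.val (f.apply_symm_apply (latticeBasis l hl i))
    rw [det_rho, hc]
    simp only [latticeBasis_apply]

end Regulator

end Carlitz

end

theorem mainTheorem3 (k : Type*) [Field k] [Fintype k] [DecidableEq (RatFunc k)]
    (K : Type*) [Field K] [Algebra (RatFunc k) K] [FiniteDimensional (RatFunc k) K]
    [Algebra k[X] K] [IsScalarTower k[X] (RatFunc k) K] :
    -- the connecting map `E(K_∞) → H¹(G, Λ_E)` is well defined
    (∃ δ : Carlitz.Points k (Carlitz.KInf k K) →ₗ[k[X]] Carlitz.H1 k K,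
      δ.graph = Carlitz.connectingGraph k K) ∧
    -- `H_R` is finite
    Finite (Carlitz.HR k K) ∧
    -- the regulator is well defined
    (∃! r : Carlitz.KInfty k, Carlitz.IsRegulator k K r) ∧
    -- `v(Reg_R · |H_R|) = 0` and `v(Reg_R) = dim_k H_R`, for the multiplicatively written `v`
    ∀ Reg : Carlitz.KInfty k, Carlitz.IsRegulator k K Reg →
      Valued.v (Reg * algebraMap k[X] (Carlitz.KInfty k)
        (Carlitz.fittingCard k (Carlitz.HR k K))) = (1 : ℤᵐ⁰) ∧
      Valued.v Reg = WithZero.exp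
        (-(Module.finrank k (RestrictScalars k k[X] (Carlitz.HR k K)) : ℤ)) := by
  obtain ⟨h, l, l', hcard, hl, hl', hdet⟩ := Carlitz.exists_bases (k := k) (K := K)
  have hq : 1 < Fintype.card k := Fintype.one_lt_card
  have hfin : Finite (Carlitz.HR k K) :=
    Nat.finite_of_card_ne_zero (hcard ▸ (pow_pos (by omega) h).ne')
  obtain ⟨hpow, hne, hdeg⟩ := Carlitz.finite_module_card k (Carlitz.HR k K)
  have hrank : Module.finrank k (RestrictScalars k k[X] (Carlitz.HR k K)) = h := by
    rw [hcard, Nat.card_eq_fintype_card] at hpow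
    exact (Nat.pow_right_injective hq hpow).symm
  have hdet0 : l.det l' ≠ 0 := by
    rw [← Valuation.ne_zero_iff Valued.v, hdet]
    exact WithZero.exp_ne_zero
  refine ⟨Carlitz.exists_connectingMap k K, hfin, ?_, fun Reg hReg => ?_⟩
  · simp only [Carlitz.isRegulator_iff hl hl']
    exact Carlitz.existsUnique_isMonic hdet0
  · obtain ⟨-, u, rfl⟩ := (Carlitz.isRegulator_iff hl hl' Reg).mp hReg
    have hv : Valued.v ((u : k[X]) • l.det l') = WithZero.exp (-(h : ℤ)) := by
      rw [Carlitz.polynomial_smul_eq, smul_eq_mul, map_mul, Carlitz.valued_unit, one_mul, hdet]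
    have hfit : Valued.v (algebraMap k[X] (Carlitz.KInfty k)
        (Carlitz.fittingCard k (Carlitz.HR k K))) = WithZero.exp (h : ℤ) := by
      rw [hrank] at hdeg
      rw [← hdeg]
      exact Carlitz.valued_polynomial hne
    refine ⟨?_, by rw [hv, hrank]⟩
    rw [map_mul, hv, hfit, ← WithZero.exp_add, neg_add_cancel, WithZero.exp_zero]
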